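/- Let $K\subset S^3$ be a knot, $X(K)=S^3\setminus K$, and let $X_\infty(K)\to X(K)$ be its infinite cyclic cover (the connected cover belonging to the commutator subgroup of $\pi_1(X(K))$), with generator $t$ of its group of deck transformations $\cong\mathbb{Z}$ (the meridian action). Let $\Delta_K(t)=\sum_{i=0}^n a_i t^i\in\mathbb{Z}[t]$ with $a_0a_n\neq 0$ be the Alexander polynomial of $K$, that is, a greatest common divisor in $\mathbb{Z}[t^{\pm1}]$ of the initial Fitting ideal of the (finitely generated) $\mathbb{Z}[t^{\pm1}]$-module $H_1(X_\infty(K);\mathbb{Z})$, and let $\alpha_1,\dots,\alpha_n\in\overline{\mathbb{Q}}$ be its zeros, counted with multiplicity. For every prime $p$ fix an embedding $\overline{\mathbb{Q}}\to\overline{\mathbb{Q}_p}$ and let $|\cdot|_p$ be the $p$-adic absolute value on $\overline{\mathbb{Q}}$ obtained from it. Let $h(t_p)$ be the entropy of the automorphism $t_p$ of $V_p=H_1(X_\infty(K);\mathbb{Q}_p)$ induced by $t$, that is, $$h(t_p)=\lim_{\varepsilon\to0}\limsup_{m\to\infty}\Bigl[-\frac1m\log\mu\Bigl(\bigcap_{k=0}^{m-1}t_p^{-k}B(0,\varepsilon)\Bigr)\Bigr],$$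 where $\mu$ is a Haar measure on $V_p$ and $B(0,\varepsilon)$ is the open $\varepsilon$-ball for the maximum norm with respect to a $\mathbb{Q}_p$-basis of $V_p$. Then every $V_p$ is finite-dimensional over $\mathbb{Q}_p$, and, for any choice of the bases, $$\log|a_n|=\sum_{p<\infty}h(t_p)\qquad\text{and}\qquad \log|a_n|=\sum_{p<\infty}\ \sum_{|\alpha_i|_p>1}\log|\alpha_i|_p ,$$ where $p$ runs through all prime numbers. -/

import Mathlib

open CategoryTheory Polynomial LaurentPolynomial MeasureTheory

noncomputable section

instance Nat.Primes.factPrimeCoe (p : Nat.Primes) : Fact (p : ℕ).Prime := ⟨p.2⟩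

/-- The 3-sphere, as the unit sphere of Euclidean 4-space. -/
abbrev ThreeSphere : Type := Metric.sphere (0 : EuclideanSpace ℝ (Fin 4)) 1

/-- A knot: the image of a circle under a topological embedding into the 3-sphere. -/
def IsKnot (K : Set ThreeSphere) : Prop :=
  ∃ f : Circle → ThreeSphere, Topology.IsEmbedding f ∧ Set.range f = K

/-- The infinite cyclic cover of a space `X` (such as a knot complement) whose fundamental group
has infinite cyclic abelianization: a path connected covering space `E` of `X` which belongs to
the commutator subgroup of the fundamental group, together with a generator `t` of its
group of deck transformations, which is infinite cyclic.
For a knot complement, `t` is the deck transformation given by a meridian. -/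
structure InfiniteCyclicCover (X : Type) [TopologicalSpace X] where
  /-- the total space -/
  E : Type
  [top : TopologicalSpace E]
  [conn : PathConnectedSpace E]
  /-- the covering projection -/
  proj : C(E, X)
  isCoveringMap : IsCoveringMap proj
  surjective : Function.Surjective proj
  range_map : ∀ e : E, (FundamentalGroup.map proj e).range = commutator (FundamentalGroup X (proj e))
  /-- the generating deck transformation -/
  t : E ≃ₜ E
  proj_t : ∀ e, proj (t e) = proj e
  /-- the powers of `t` act transitively on the fibres -/
  transitive : ∀ e e' : E, proj e = proj e' → ∃ n : ℤ, (t ^ n) e = e'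
  /-- the powers of `t` act freely -/
  free : ∀ (n : ℤ) (e : E), (t ^ n) e = e → n = 0

attribute [instance] InfiniteCyclicCover.top InfiniteCyclicCover.conn

/-- First singular homology `H₁(E; R)`. -/
abbrev H1 (R : Type) [CommRing R] (E : Type) [TopologicalSpace E] : ModuleCat.{0} R :=
  ((AlgebraicTopology.singularHomologyFunctor (ModuleCat.{0} R) 1).obj (ModuleCat.of R R)).obj
    (TopCat.of E)

/-- The automorphism of `H₁(E; R)` induced by a homeomorphism of `E`. -/
def H1.equiv (R : Type) [CommRing R] {E : Type} [TopologicalSpace E] (t : E ≃ₜ E) :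
    H1 R E ≃ₗ[R] H1 R E :=
  (((AlgebraicTopology.singularHomologyFunctor (ModuleCat.{0} R) 1).obj (ModuleCat.of R R)).mapIso
    (TopCat.isoOfHomeo t)).toLinearEquiv

/-- The ring homomorphism `ℤ[t, t⁻¹] → End M` sending the indeterminate to the automorphism `t`. -/
def laurentAction {M : Type} [AddCommGroup M] [Module ℤ M] (t : M ≃ₗ[ℤ] M) : ℤ[T;T⁻¹] →ₐ[ℤ] Module.End ℤ M :=
  AddMonoidAlgebra.lift ℤ (Module.End ℤ M) ℤ
    ((LinearEquiv.automorphismGroup.toLinearMapMonoidHom (R := ℤ) (M := M)).comp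
      (zpowersHom (M ≃ₗ[ℤ] M) t))

namespace InfiniteCyclicCover

variable {X : Type} [TopologicalSpace X]

/-- The meridian action on `H₁(X_∞; R)`. -/
def meridian (C : InfiniteCyclicCover X) (R : Type) [CommRing R] : H1 R C.E ≃ₗ[R] H1 R C.E :=
  H1.equiv R C.t

/-- The Alexander module: `H₁(X_∞; ℤ)` as a module over `ℤ[t, t⁻¹]`,
where `t` acts as the meridian. -/
def AlexanderModule (C : InfiniteCyclicCover X) : Type := H1 ℤ C.E

instance (C : InfiniteCyclicCover X) : AddCommGroup C.AlexanderModule :=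
  inferInstanceAs (AddCommGroup (H1 ℤ C.E))

instance (C : InfiniteCyclicCover X) : Module ℤ[T;T⁻¹] C.AlexanderModule :=
  Module.compHom (H1 ℤ C.E) (laurentAction (C.meridian ℤ)).toRingHom

end InfiniteCyclicCover

/-- The initial (zeroth) Fitting ideal of the `R`-module generated by `x 0, …, x (n-1)`: the ideal
generated by the `n × n` minors of the relations among these generators.
By Fitting's lemma it depends on the module only, not on the finite family of generators. -/
def initialFittingIdeal {R M : Type} [CommRing R] [AddCommGroup M] [Module R M] {n : ℕ}
    (x : Fin n → M) : Ideal R :=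
  Ideal.span {d | ∃ A : Matrix (Fin n) (Fin n) R, (∀ i, ∑ j, A i j • x j = 0) ∧ A.det = d}

/-- `d` is a greatest common divisor of the elements of the ideal `I`. -/
def IsGCDOfIdeal {R : Type} [CommRing R] (I : Ideal R) (d : R) : Prop :=
  (∀ a ∈ I, d ∣ a) ∧ ∀ c, (∀ a ∈ I, c ∣ a) → c ∣ d

/-- `Δ` is an Alexander polynomial, i.e. a greatest common divisor in `ℤ[t, t⁻¹]` of the initial
Fitting ideal of the (finitely generated) Alexander module, written as an ordinary polynomial
`a₀ + a₁ t + ⋯ + aₙ tⁿ` with `a₀ ≠ 0`. -/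
def IsAlexanderPolynomial {X : Type} [TopologicalSpace X] (C : InfiniteCyclicCover X)
    (Δ : ℤ[X]) : Prop :=
  Δ.coeff 0 ≠ 0 ∧ ∃ (n : ℕ) (x : Fin n → C.AlexanderModule),
    Submodule.span ℤ[T;T⁻¹] (Set.range x) = ⊤ ∧
      IsGCDOfIdeal (initialFittingIdeal (R := ℤ[T;T⁻¹]) x) (Polynomial.toLaurent Δ)

/-- Bowen's entropy `lim_{ε → 0} limsup_n (-(1/n) log μ(⋂_{k<n} T⁻ᵏ B(0, ε)))`;
the inner limsup is antitone in `ε`, so that the limit is the supremum over `ε > 0`. -/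
def bowenEntropy {V : Type} [SeminormedAddCommGroup V] [MeasurableSpace V] (μ : Measure V)
    (T : V → V) : EReal :=
  ⨆ ε : Set.Ioi (0 : ℝ), Filter.limsup
    (fun n : ℕ => -(ENNReal.log (μ (⋂ k ∈ Finset.range n, T^[k] ⁻¹' Metric.ball 0 ε)) / (n : EReal)))
    Filter.atTop

/-- The entropy of an endomorphism `T` of a finite-dimensional `ℚ_p`-vector space with basis `b`:
Bowen's entropy of `T` in the coordinates of `b`, for the (invariant) maximum metric and a
Haar measure on `ℚ_p^d`. -/
def padicEntropy {p : ℕ} [Fact p.Prime] {V : Type} [AddCommGroup V] [Module ℚ_[p] V] {d : ℕ}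
    (b : Module.Basis (Fin d) ℚ_[p] V) (T : V →ₗ[ℚ_[p]] V) : EReal :=
  letI : MeasurableSpace (Fin d → ℚ_[p]) := borel _
  haveI : BorelSpace (Fin d → ℚ_[p]) := ⟨rfl⟩
  bowenEntropy (Measure.addHaar : Measure (Fin d → ℚ_[p]))
    fun v => b.equivFun (T (b.equivFun.symm v))

/-- The local sum of `log |α|_p` over the zeros `α` of `Δ` in the algebraic closure of `ℚ`,
counted with multiplicity, with `|α|_p > 1`. The `p`-adic absolute value is taken through an
embedding `ι` into the algebraic closure of `ℚ_p`. -/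
def localZeroSum (Δ : ℤ[X]) (p : ℕ) [Fact p.Prime] (ι : AlgebraicClosure ℚ →+* PadicAlgCl p) : ℝ :=
  open Classical in
  (((Δ.aroots (AlgebraicClosure ℚ)).filter fun α => 1 < ‖ι α‖).map fun α => Real.log ‖ι α‖).sum

end

/-!
Both sums equal the sum over all primes `p` of the local term `-log |a_n|_p` of the leading
coefficient `a_n` of the Alexander polynomial `Δ`, term by term, and by the product formula
(`hasSum_neg_log_norm`) this sum is `log |a_n|`.

**The module over `ℚ_p`.** Since `ℚ_p` is flat over `ℤ`, the first homology `V_p` of the cover with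
coefficients in `ℚ_p` is the base change of the Alexander module (`exists_isBaseChange_H1`). The
initial Fitting ideal does not depend on the generators (`initialFittingIdeal_eq`), and over the
principal ideal domain `ℚ_p[t]` that of the base change is generated by the image of `Δ`: a nonzero
integral multiple of `Δ` lies in the integral Fitting ideal (`IsGCDOfIdeal.exists_int_mul_mem`), and
minors over one of the two rings lead to minors over the other
(`exists_map_mem_initialFittingIdeal`, `initialFittingIdeal_map_le`). So `V_p` is a finite product
of modules `ℚ_p[t] ⧸ (f i)` with `∏ f i` equal to `Δ` up to a unit
(`exists_equiv_pi_adjoinRoot_of_isBaseChange`); in particular it has finite dimension.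

**The value at one.** The cover belongs to the commutator subgroup, so its loops project to
commutators. Lifting paths defines a homomorphism from the fundamental group of the base to the
abelian group of `1`-chains of the cover modulo boundaries and the image of `t - 1`; it kills
commutators, and it follows that `t - 1` is surjective on the Alexander module
(`meridian_sub_one_surjective`). Expressing the generators as `t - 1` times combinations of
themselves gives an element of the Fitting ideal with value `1` at `t = 1`, so that `Δ(1) = ±1`
(`isUnit_eval_one`). Hence `Δ` is primitive, also over `ℤ_p`. For a module with a non-primitive
`Δ` the formulas fail, as the content of `Δ` is invisible over `ℚ_p`.

**The entropy.** An element of `ℚ_p[t] ⧸ (f)` is the same as a linear recurrent sequence with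
characteristic polynomial `f` (`topCoeff`), and `t` acts as the shift. The sequences whose first
`n + deg f` terms are bounded by a constant form a decreasing chain of subgroups `boundedTerms`, and
each Bowen ball lies between the corresponding members of two such chains, for two different
constants. Let `g i` be a primitive multiple over `ℤ_p` of `f i`. The recursion given by `g i` shows
that a sequence with integral terms up to some point has its next term in `ℤ_p` divided by the
leading coefficient of `g i`, and Gauss's lemma shows that this bound is attained
(`exists_norm_leadingCoeff_mul_topCoeff_eq`). So each member of the chain has index `∏ i, p ^ v i`
in the preceding one, where `v i` is the valuation of the leading coefficient of `g i`
(`relIndex_boundedTerms`), and the entropy is the logarithm of this index (`padicEntropy_eq`). By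
Gauss's lemma again `∏ g i` is the primitive polynomial `Δ` up to a unit of `ℤ_p`, and so the
logarithm is `-log |a_n|_p` (`log_prod_pow_valuation`).

**The zeros.** The Gauss norm of `Δ` over the algebraic closure of `ℚ_p` is `1`, as `Δ` is
primitive. Being multiplicative, it is also `|a_n|_p * ∏ max 1 |α_i|_p`, which identifies the sum
over the zeros with `-log |a_n|_p` (`localZeroSum_eq`).
-/

noncomputable section

/-! ### Singular chains as free modules -/

section SingularHomology

open scoped Simplicial

namespace SSet

/-- The simplicial chain complex of a simplicial set with coefficients in a ring `R`. -/
abbrev chains (R : Type) [CommRing R] (X : SSet.{0}) : ChainComplex (ModuleCat.{0} R) ℕ :=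
  X.chainComplex (ModuleCat.of R R)

/-- The map of chain complexes induced by a map of simplicial sets. -/
abbrev chainsMap (R : Type) [CommRing R] {X Y : SSet.{0}} (f : X ⟶ Y) : X.chains R ⟶ Y.chains R :=
  SSet.chainComplexMap f (ModuleCat.of R R)

/-- An `n`-simplex, viewed as an `n`-chain. -/
def simplexChain (R : Type) [CommRing R] (X : SSet.{0}) {n : ℕ} (x : X _⦋n⦌) :
    (X.chains R).X n :=
  (X.ιChainComplex (R := ModuleCat.of R R) x).hom (1 : R)

section

variable (R : Type) [CommRing R] (X : SSet.{0}) {n : ℕ} {M : Type} [AddCommGroup M] [Module R M]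

/-- The linear map on `n`-chains with prescribed values on the simplices. -/
def chainsDesc (f : X _⦋n⦌ → M) : (X.chains R).X n →ₗ[R] M :=
  (Limits.Cofan.IsColimit.desc (X.isColimitChainComplexXCofan (ModuleCat.of R R) n)
    (A := ModuleCat.of R M) fun x => ModuleCat.ofHom (LinearMap.toSpanSingleton R M (f x))).hom

theorem chainsDesc_simplexChain (f : X _⦋n⦌ → M) (x : X _⦋n⦌) :
    X.chainsDesc R f (X.simplexChain R x) = f x := by
  have h := congrArg (fun g => ModuleCat.Hom.hom g (1 : R))
    (Limits.Cofan.IsColimit.fac (X.isColimitChainComplexXCofan (ModuleCat.of R R) n)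
      (A := ModuleCat.of R M)
      (fun x => ModuleCat.ofHom (LinearMap.toSpanSingleton R M (f x))) x)
  simp only [ModuleCat.hom_comp, LinearMap.comp_apply, ModuleCat.hom_ofHom,
    LinearMap.toSpanSingleton_apply, one_smul] at h
  exact h

variable {R X}

theorem chains_hom_ext {f g : (X.chains R).X n →ₗ[R] M}
    (h : ∀ x : X _⦋n⦌, f (X.simplexChain R x) = g (X.simplexChain R x)) : f = g := by
  have : ModuleCat.ofHom f = ModuleCat.ofHom g := by
    apply SSet.chainComplex_hom_ext
    intro x
    ext
    exact h x
  exact congrArg (fun g => g.hom) this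

variable (R X n)

/-- The simplices form a basis of the module of chains. -/
def chainsBasis : Module.Basis (X _⦋n⦌) R ((X.chains R).X n) :=
  .ofRepr (.ofLinearMap (X.chainsDesc R fun x => Finsupp.single x 1)
    (Finsupp.linearCombination R (X.simplexChain R))
    (by ext x; simp [chainsDesc_simplexChain])
    (by apply chains_hom_ext; intro x; simp [chainsDesc_simplexChain]))

theorem chainsBasis_apply (x : X _⦋n⦌) : X.chainsBasis R n x = X.simplexChain R x := by
  simp [chainsBasis]

end

variable (R : Type) [CommRing R]

theorem d_simplexChain (X : SSet.{0}) {n : ℕ} (x : X _⦋n + 1⦌) :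
    ((X.chains R).d (n + 1) n).hom (X.simplexChain R x) =
      ∑ i : Fin (n + 2), (-1 : ℤ) ^ i.val • X.simplexChain R (X.δ i x) := by
  have h := congrArg (fun g => ModuleCat.Hom.hom g (1 : R))
    (X.ιChainComplex_d (R := ModuleCat.of R R) x)
  simp only [ModuleCat.hom_comp, LinearMap.comp_apply, ModuleCat.hom_sum, LinearMap.sum_apply,
    ModuleCat.hom_zsmul, LinearMap.smul_apply] at h
  exact h

theorem chainsMap_simplexChain {X Y : SSet.{0}} (f : X ⟶ Y) {n : ℕ} (x : X _⦋n⦌) :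
    ((chainsMap R f).f n).hom (X.simplexChain R x) = Y.simplexChain R (f.app _ x) := by
  have h := congrArg (fun g => ModuleCat.Hom.hom g (1 : R))
    (SSet.ι_chainComplexMap_f X Y f (ModuleCat.of R R) x)
  simp only [ModuleCat.hom_comp, LinearMap.comp_apply] at h
  exact h

end SSet

namespace ChainComplex

variable {R : Type} [CommRing R] (K : ChainComplex (ModuleCat.{0} R) ℕ)

theorem pOpcycles_surjective (n : ℕ) : Function.Surjective (K.pOpcycles n).hom :=
  (ModuleCat.epi_iff_surjective _).1 inferInstance

theorem exact_d_pOpcycles (n : ℕ) :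
    Function.Exact (K.d (n + 1) n).hom (K.pOpcycles n).hom :=
  (ShortComplex.ShortExact.moduleCat_exact_iff_function_exact _).1
    (ShortComplex.exact_of_g_is_cokernel (.mk (K.d (n + 1) n) (K.pOpcycles n) (by simp))
      (K.opcyclesIsCokernel (n + 1) n (by simp)))

theorem homologyι_injective (n : ℕ) : Function.Injective (K.homologyι n).hom :=
  (ModuleCat.mono_iff_injective _).1 inferInstance

theorem exact_homologyι_fromOpcycles (n : ℕ) :
    Function.Exact (K.homologyι (n + 1)).hom (K.fromOpcycles (n + 1) n).hom :=
  (ShortComplex.ShortExact.moduleCat_exact_iff_function_exact _).1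
    (ShortComplex.exact_of_f_is_kernel
      (.mk (K.homologyι (n + 1)) (K.fromOpcycles (n + 1) n) (by simp))
      (K.homologyIsKernel (n + 1) n (by simp)))

theorem fromOpcycles_pOpcycles (n m : ℕ) (x : K.X n) :
    (K.fromOpcycles n m).hom ((K.pOpcycles n).hom x) = (K.d n m).hom x := by
  rw [← LinearMap.comp_apply, ← ModuleCat.hom_comp, K.p_fromOpcycles]

variable {K} {L : ChainComplex (ModuleCat.{0} R) ℕ} (φ : K ⟶ L) (n : ℕ)

theorem opcyclesMap_pOpcycles (x : K.X n) :
    (HomologicalComplex.opcyclesMap φ n).hom ((K.pOpcycles n).hom x) =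
      (L.pOpcycles n).hom ((φ.f n).hom x) := by
  rw [← LinearMap.comp_apply, ← ModuleCat.hom_comp, HomologicalComplex.p_opcyclesMap]; rfl

theorem homologyι_homologyMap (x : K.homology n) :
    (L.homologyι n).hom ((HomologicalComplex.homologyMap φ n).hom x) =
      (HomologicalComplex.opcyclesMap φ n).hom ((K.homologyι n).hom x) := by
  rw [← LinearMap.comp_apply, ← ModuleCat.hom_comp, HomologicalComplex.homologyι_naturality]; rfl

theorem fromOpcycles_opcyclesMap (m : ℕ) (x : K.opcycles n) :
    (L.fromOpcycles n m).hom ((HomologicalComplex.opcyclesMap φ n).hom x) =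
      (φ.f m).hom ((K.fromOpcycles n m).hom x) := by
  obtain ⟨y, rfl⟩ := pOpcycles_surjective K n x
  rw [opcyclesMap_pOpcycles, fromOpcycles_pOpcycles, fromOpcycles_pOpcycles,
    ← LinearMap.comp_apply, ← ModuleCat.hom_comp, φ.comm]; rfl

end ChainComplex

/-! ### Extension of scalars for singular homology -/

namespace SSet

variable (K : Type) [CommRing K] (X : SSet.{0}) (n : ℕ)

/-- The map from integral chains to chains with coefficients in `K`. -/
def chainsToChains : (X.chains ℤ).X n →ₗ[ℤ] (X.chains K).X n :=
  X.chainsDesc ℤ fun x => X.simplexChain K x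

theorem chainsToChains_simplexChain (x : X _⦋n⦌) :
    X.chainsToChains K n (X.simplexChain ℤ x) = X.simplexChain K x :=
  chainsDesc_simplexChain ..

theorem isBaseChange_chainsToChains : IsBaseChange K (X.chainsToChains K n) := by
  have h := (IsBaseChange.of_basis ℤ (X.chainsBasis K n)).comp_equiv (X.chainsBasis ℤ n).repr
  convert h using 1
  apply chains_hom_ext
  intro x
  rw [chainsToChains_simplexChain]
  simp [← chainsBasis_apply]

theorem chainsToChains_d (x : (X.chains ℤ).X (n + 1)) :
    X.chainsToChains K n (((X.chains ℤ).d (n + 1) n).hom x) =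
      ((X.chains K).d (n + 1) n).hom (X.chainsToChains K (n + 1) x) := by
  suffices h : X.chainsToChains K n ∘ₗ ((X.chains ℤ).d (n + 1) n).hom =
      ((X.chains K).d (n + 1) n).hom.restrictScalars ℤ ∘ₗ X.chainsToChains K (n + 1) from
    LinearMap.congr_fun h x
  apply chains_hom_ext
  intro x
  simp [chainsToChains_simplexChain, d_simplexChain]

theorem chainsToChains_chainsMap {Y : SSet.{0}} (f : X ⟶ Y) (x : (X.chains ℤ).X n) :
    Y.chainsToChains K n (((chainsMap ℤ f).f n).hom x) =
      ((chainsMap K f).f n).hom (X.chainsToChains K n x) := by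
  suffices h : Y.chainsToChains K n ∘ₗ ((chainsMap ℤ f).f n).hom =
      ((chainsMap K f).f n).hom.restrictScalars ℤ ∘ₗ X.chainsToChains K n from
    LinearMap.congr_fun h x
  apply chains_hom_ext
  intro x
  simp only [LinearMap.comp_apply, LinearMap.coe_restrictScalars]
  rw [chainsMap_simplexChain, chainsToChains_simplexChain, chainsToChains_simplexChain,
    chainsMap_simplexChain]

end SSet

/-- Universal coefficients for a flat coefficient ring: the change of coefficients in first homology
exhibits its target as the extension of scalars of its source. -/
theorem SSet.exists_isBaseChange_homology (K : Type) [CommRing K] [Module.Flat ℤ K] {X : SSet.{0}}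
    (φ : X ⟶ X) :
    ∃ j : (X.chains ℤ).homology 1 →ₗ[ℤ] (X.chains K).homology 1, IsBaseChange K j ∧
      ∀ a, j ((HomologicalComplex.homologyMap (SSet.chainsMap ℤ φ) 1).hom a) =
        (HomologicalComplex.homologyMap (SSet.chainsMap K φ) 1).hom (j a) := by
  let C := X.chains ℤ
  let D := X.chains K
  have hC := ChainComplex.pOpcycles_surjective C 1
  -- the map on chains modulo boundaries
  obtain ⟨q, hq⟩ : ∃ q : C.opcycles 1 →ₗ[ℤ] D.opcycles 1,
      ∀ x, q ((C.pOpcycles 1).hom x) = (D.pOpcycles 1).hom (X.chainsToChains K 1 x) := by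
    let g : C.X 1 →ₗ[ℤ] D.opcycles 1 :=
      (D.pOpcycles 1).hom.restrictScalars ℤ ∘ₗ X.chainsToChains K 1
    have hg (x y : C.X 1) (h : (C.pOpcycles 1).hom x = (C.pOpcycles 1).hom y) : g x = g y := by
      rw [← sub_eq_zero, ← map_sub] at h ⊢
      obtain ⟨z, hz⟩ := (ChainComplex.exact_d_pOpcycles C 1 _).1 h
      change (D.pOpcycles 1).hom (X.chainsToChains K 1 _) = 0
      rw [← hz, X.chainsToChains_d K 1 z]
      exact (ChainComplex.exact_d_pOpcycles D 1).apply_apply_eq_zero _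
    choose s hs using hC
    refine ⟨{ toFun := fun x => g (s x), map_add' := fun x y => ?_, map_smul' := fun n x => ?_ },
      fun x => hg _ _ (hs _)⟩
    · rw [← map_add]; exact hg _ _ (by simp only [map_add, hs])
    · rw [RingHom.id_apply, ← g.map_smul]
      exact hg _ _ (by rw [LinearMap.map_smul, hs, hs])
  have hqb : IsBaseChange K q :=
    IsBaseChange.of_right_exact (f := (C.d 2 1).hom) (g := (C.pOpcycles 1).hom)
      (f' := (D.d 2 1).hom) (g' := (D.pOpcycles 1).hom) K
      (X.chainsToChains K 2) (X.chainsToChains K 1) q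
      (LinearMap.ext fun x => X.chainsToChains_d K 1 x) (LinearMap.ext hq)
      (X.isBaseChange_chainsToChains K 2) (X.isBaseChange_chainsToChains K 1)
      (ChainComplex.exact_d_pOpcycles C 1) hC
      (ChainComplex.exact_d_pOpcycles D 1) (ChainComplex.pOpcycles_surjective D 1)
  have hqd (x : C.opcycles 1) : X.chainsToChains K 0 ((C.fromOpcycles 1 0).hom x) =
      (D.fromOpcycles 1 0).hom (q x) := by
    obtain ⟨y, rfl⟩ := hC x
    rw [hq, ChainComplex.fromOpcycles_pOpcycles, ChainComplex.fromOpcycles_pOpcycles]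
    exact X.chainsToChains_d K 0 y
  -- the map on homology
  have hr (x : C.homology 1) : ∃ y : D.homology 1,
      (D.homologyι 1).hom y = q ((C.homologyι 1).hom x) := by
    refine (ChainComplex.exact_homologyι_fromOpcycles D 0 _).1 ?_
    rw [← hqd, (ChainComplex.exact_homologyι_fromOpcycles C 0).apply_apply_eq_zero, map_zero]
  choose r hr using hr
  have hinj := ChainComplex.homologyι_injective D 1
  let j : C.homology 1 →ₗ[ℤ] D.homology 1 :=
    { toFun := r
      map_add' := fun x y => hinj (by rw [hr]; simp only [map_add]; rw [hr, hr])
      map_smul' := fun n x => hinj (by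
        rw [hr, LinearMap.map_smul, q.map_smul, RingHom.id_apply, map_zsmul, hr]) }
  have hj (x) : (D.homologyι 1).hom (j x) = q ((C.homologyι 1).hom x) := hr x
  refine ⟨j, ?_, fun a => hinj ?_⟩
  · exact IsBaseChange.of_left_exact (f := (C.homologyι 1).hom) (g := (C.fromOpcycles 1 0).hom)
      (f' := (D.homologyι 1).hom) (g' := (D.fromOpcycles 1 0).hom) K
      j q (X.chainsToChains K 0) (LinearMap.ext fun x => (hj x).symm) (LinearMap.ext hqd)
      hqb (X.isBaseChange_chainsToChains K 0)
      (ChainComplex.exact_homologyι_fromOpcycles C 0) (ChainComplex.homologyι_injective C 1)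
      (ChainComplex.exact_homologyι_fromOpcycles D 0) (ChainComplex.homologyι_injective D 1)
  · rw [hj, ChainComplex.homologyι_homologyMap, ChainComplex.homologyι_homologyMap, hj]
    obtain ⟨y, hy⟩ := hC ((C.homologyι 1).hom a)
    rw [← hy, ChainComplex.opcyclesMap_pOpcycles, hq, hq, ChainComplex.opcyclesMap_pOpcycles,
      X.chainsToChains_chainsMap K 1]

/-- Universal coefficients in the flat case: first homology commutes with flat extension of scalars,
compatibly with the action of a homeomorphism. -/
theorem exists_isBaseChange_H1 (K : Type) [CommRing K] [Module.Flat ℤ K] {E : Type}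
    [TopologicalSpace E] (t : E ≃ₜ E) :
    ∃ j : H1 ℤ E →ₗ[ℤ] H1 K E, IsBaseChange K j ∧
      ∀ a, j (H1.equiv ℤ t a) = H1.equiv K t (j a) := by
  obtain ⟨j, h1, h2⟩ :=
    SSet.exists_isBaseChange_homology K (X := TopCat.toSSet.obj (TopCat.of E))
      (TopCat.toSSet.map (TopCat.isoOfHomeo (X := TopCat.of E) (Y := TopCat.of E) t).hom)
  refine ⟨j, ?_, ?_⟩
  · exact h1
  · exact h2

end SingularHomology

/-! ### Chains of paths modulo boundaries -/

section InfiniteCyclicCovers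

open scoped Simplicial unitInterval

section PathClass

variable {E : Type} [TopologicalSpace E]

/-- The integral singular chain complex of a space. -/
abbrev singularChains (E : Type) [TopologicalSpace E] : ChainComplex (ModuleCat.{0} ℤ) ℕ :=
  (TopCat.toSSet.obj (TopCat.of E)).chains ℤ

/-- A parametrized path as a singular `1`-simplex. -/
def pathSimplex (f : C(I, E)) : (TopCat.toSSet.obj (TopCat.of E)) _⦋1⦌ :=
  (TopCat.toSSetObjEquiv (TopCat.of E) (.op ⦋1⦌)).symm
    (f.comp ⟨stdSimplexHomeomorphUnitInterval, stdSimplexHomeomorphUnitInterval.continuous⟩)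

theorem pathSimplex_surjective : Function.Surjective (pathSimplex (E := E)) := fun x => by
  refine ⟨(TopCat.toSSetObjEquiv (TopCat.of E) (.op ⦋1⦌) x).comp
    ⟨stdSimplexHomeomorphUnitInterval.symm, stdSimplexHomeomorphUnitInterval.symm.continuous⟩, ?_⟩
  rw [pathSimplex, Equiv.symm_apply_eq]
  ext y
  exact congrArg (TopCat.toSSetObjEquiv (TopCat.of E) (.op ⦋1⦌) x)
    (stdSimplexHomeomorphUnitInterval.symm_apply_apply y)

/-- The class of a parametrized path in the quotient of the singular `1`-chains by boundaries. -/
def pathClass (f : C(I, E)) : (singularChains E).opcycles 1 :=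
  ((singularChains E).pOpcycles 1).hom (SSet.simplexChain ℤ _ (pathSimplex f))

/-- A point as a singular `0`-chain. -/
def pointChain (y : E) : (singularChains E).X 0 :=
  SSet.simplexChain ℤ _ (TopCat.toSSetObj₀Equiv (X := TopCat.of E).symm y)

theorem fromOpcycles_pathClass (f : C(I, E)) :
    ((singularChains E).fromOpcycles 1 0).hom (pathClass f) =
      pointChain (f 1) - pointChain (f 0) := by
  have h := SSet.d_simplexChain ℤ (TopCat.toSSet.obj (TopCat.of E)) (n := 0) (pathSimplex f)
  rw [Fin.sum_univ_two (M := (singularChains E).X 0)] at h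
  have h0 : (TopCat.toSSet.obj (TopCat.of E)).δ 0 (pathSimplex f) =
      TopCat.toSSetObj₀Equiv (X := TopCat.of E).symm (f 1) := by
    rw [Equiv.eq_symm_apply]
    change f (stdSimplexHomeomorphUnitInterval (stdSimplex.map (Fin.succAbove 0) default)) = _
    rw [Subsingleton.elim (default : stdSimplex ℝ (Fin 1)) (stdSimplex.vertex 0),
      stdSimplex.map_vertex]
    rfl
  have h1 : (TopCat.toSSet.obj (TopCat.of E)).δ 1 (pathSimplex f) =
      TopCat.toSSetObj₀Equiv (X := TopCat.of E).symm (f 0) := by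
    rw [Equiv.eq_symm_apply]
    change f (stdSimplexHomeomorphUnitInterval (stdSimplex.map (Fin.succAbove 1) default)) = _
    rw [Subsingleton.elim (default : stdSimplex ℝ (Fin 1)) (stdSimplex.vertex 0),
      stdSimplex.map_vertex]
    rfl
  rw [h0, h1] at h
  rw [pathClass, ChainComplex.fromOpcycles_pOpcycles]
  refine h.trans ?_
  simp [pointChain, sub_eq_add_neg]

theorem stdSimplex.coe_map_succAbove (i : Fin 3) (x : stdSimplex ℝ (Fin 2)) (j : Fin 3) :
    (stdSimplex.map i.succAbove x : Fin 3 → ℝ) j =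
      (if i.succAbove 0 = j then x.1 0 else 0) + if i.succAbove 1 = j then x.1 1 else 0 := by
  rw [stdSimplex.map_coe, FunOnFinite.linearMap_apply_apply, Finset.sum_filter, Fin.sum_univ_two]
  rfl

/-- The boundary of a singular triangle. -/
theorem pathClass_triangle (f : C(stdSimplex ℝ (Fin 3), E)) (a b c : C(I, E))
    (ha : ∀ x, f (stdSimplex.map (Fin.succAbove 0) x) = a (stdSimplexHomeomorphUnitInterval x))
    (hb : ∀ x, f (stdSimplex.map (Fin.succAbove 1) x) = b (stdSimplexHomeomorphUnitInterval x))
    (hc : ∀ x, f (stdSimplex.map (Fin.succAbove 2) x) = c (stdSimplexHomeomorphUnitInterval x)) :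
    pathClass b = pathClass c + pathClass a := by
  let s : (TopCat.toSSet.obj (TopCat.of E)) _⦋2⦌ :=
    (TopCat.toSSetObjEquiv (TopCat.of E) (.op ⦋2⦌)).symm f
  have h := SSet.d_simplexChain ℤ (TopCat.toSSet.obj (TopCat.of E)) (n := 1) s
  rw [Fin.sum_univ_three (M := (singularChains E).X 1)] at h
  have h0 : (TopCat.toSSet.obj (TopCat.of E)).δ 0 s = pathSimplex a := by
    rw [pathSimplex, Equiv.eq_symm_apply]
    exact ContinuousMap.ext ha
  have h1 : (TopCat.toSSet.obj (TopCat.of E)).δ 1 s = pathSimplex b := by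
    rw [pathSimplex, Equiv.eq_symm_apply]
    exact ContinuousMap.ext hb
  have h2 : (TopCat.toSSet.obj (TopCat.of E)).δ 2 s = pathSimplex c := by
    rw [pathSimplex, Equiv.eq_symm_apply]
    exact ContinuousMap.ext hc
  rw [h0, h1, h2] at h
  have h3 := congrArg ((singularChains E).pOpcycles 1).hom h
  rw [(ChainComplex.exact_d_pOpcycles (singularChains E) 1).apply_apply_eq_zero] at h3
  simp only [Fin.val_zero, pow_zero, one_smul, Fin.val_one, pow_one, Fin.val_two,
    even_two, Even.neg_pow, one_pow, map_add, map_zsmul] at h3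
  change 0 = pathClass a + (-1 : ℤ) • pathClass b + pathClass c at h3
  have h4 : (-1 : ℤ) • pathClass b = -pathClass b := by simp
  rw [h4] at h3
  rw [← sub_eq_zero, ← neg_eq_zero, h3]
  abel

theorem pathClass_const (y : E) : pathClass (.const I y) = 0 := by
  have h := pathClass_triangle (.const _ y) (.const I y) (.const I y) (.const I y)
    (fun _ => rfl) (fun _ => rfl) (fun _ => rfl)
  simpa using h

/-- For a map of a square, the class of the diagonal is the sum of those of the bottom and the right
side, because these three bound the triangle below the diagonal. -/
theorem pathClass_square (g : C(I × I, E)) (a b c : C(I, E)) :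
    (∀ s, g (s, 0) = c s) → (∀ s, g (1, s) = a s) → (∀ s, g (s, s) = b s) →
    pathClass b = pathClass c + pathClass a := by
  intro hc ha hb
  let u : C(stdSimplex ℝ (Fin 3), I) := ⟨fun x => ⟨x 1 + x 2, by
    have := stdSimplex.sum_eq_one x
    rw [Fin.sum_univ_three] at this
    have h0 := stdSimplex.zero_le x 0
    have h1 := stdSimplex.zero_le x 1
    have h2 := stdSimplex.zero_le x 2
    constructor <;> linarith⟩, by
      refine Continuous.subtype_mk ?_ _
      exact ((continuous_apply 1).comp continuous_subtype_val).add
        ((continuous_apply 2).comp continuous_subtype_val)⟩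
  let v : C(stdSimplex ℝ (Fin 3), I) :=
    ⟨fun x => ⟨x 2, stdSimplex.zero_le x 2, stdSimplex.le_one x 2⟩,
    Continuous.subtype_mk ((continuous_apply 2).comp continuous_subtype_val) _⟩
  have key (i : Fin 3) (x : stdSimplex ℝ (Fin 2)) (s t : I)
      (hs : (stdSimplex.map i.succAbove x : Fin 3 → ℝ) 1 +
        (stdSimplex.map i.succAbove x : Fin 3 → ℝ) 2 = s)
      (ht : (stdSimplex.map i.succAbove x : Fin 3 → ℝ) 2 = t) :
      (g.comp (u.prodMk v)) (stdSimplex.map i.succAbove x) = g (s, t) := by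
    exact congrArg g (Prod.ext (Subtype.ext hs) (Subtype.ext ht))
  refine pathClass_triangle (g.comp (u.prodMk v)) a b c (fun x => ?_) (fun x => ?_) (fun x => ?_)
  · rw [← ha]
    refine key 0 x _ _ ?_ ?_
    · rw [stdSimplex.coe_map_succAbove, stdSimplex.coe_map_succAbove]
      simp only [Fin.succAbove, Fin.ext_iff]
      simpa using! stdSimplex.add_eq_one x
    · rw [stdSimplex.coe_map_succAbove]
      simp [Fin.ext_iff, Fin.succAbove]
  · rw [← hb]
    refine key 1 x _ _ ?_ ?_
    · rw [stdSimplex.coe_map_succAbove, stdSimplex.coe_map_succAbove]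
      simp [Fin.ext_iff, Fin.succAbove]
    · rw [stdSimplex.coe_map_succAbove]
      simp [Fin.ext_iff, Fin.succAbove]
  · rw [← hc]
    refine key 2 x _ _ ?_ ?_
    · rw [stdSimplex.coe_map_succAbove, stdSimplex.coe_map_succAbove]
      simp [Fin.ext_iff, Fin.succAbove]
    · rw [stdSimplex.coe_map_succAbove]
      simp [Fin.ext_iff, Fin.succAbove]

theorem pathClass_eq_of_homotopicRel {f g : C(I, E)} (h : f.HomotopicRel g {0, 1}) :
    pathClass f = pathClass g := by
  obtain ⟨H⟩ := h
  let d : C(I, E) := H.toContinuousMap.comp ((ContinuousMap.id I).prodMk (ContinuousMap.id I))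
  have h1 : pathClass d = pathClass f + pathClass (.const I (f 1)) :=
    pathClass_square (H.toContinuousMap.comp ContinuousMap.prodSwap) _ _ _
      (fun s => H.apply_zero s) (fun s => H.eq_fst s (by simp)) (fun s => rfl)
  have h2 : pathClass d = pathClass (.const I (f 0)) + pathClass g :=
    pathClass_square H.toContinuousMap _ _ _
      (fun s => H.eq_fst s (by simp)) (fun s => H.apply_one s) (fun s => rfl)
  rw [pathClass_const, add_zero] at h1
  rw [pathClass_const, zero_add] at h2
  rw [← h1, h2]

theorem pathClass_trans {x y z : E} (γ : Path x y) (γ' : Path y z) :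
    pathClass ((γ.trans γ' : Path x z) : C(I, E)) =
      pathClass (γ : C(I, E)) + pathClass (γ' : C(I, E)) := by
  let w : C(I × I, I) := ⟨fun p => ⟨(p.1 + p.2) / 2, by
    have h1 := p.1.2; have h2 := p.2.2
    constructor <;> linarith [h1.1, h1.2, h2.1, h2.2]⟩, by fun_prop⟩
  refine pathClass_square ((γ.trans γ' : C(I, E)).comp w) _ _ _ (fun s => ?_)
    (fun s => ?_) (fun s => ?_)
  · change (γ.trans γ') (w (s, 0)) = γ s
    have h : ((w (s, 0) : I) : ℝ) = s / 2 := congrArg (· / 2) (add_zero (s : ℝ))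
    rw [Path.trans_apply, dif_pos (by rw [h]; linarith [s.2.2])]
    congr 1
    exact Subtype.ext (by change 2 * _ = _; rw [h]; ring)
  · change (γ.trans γ') (w (1, s)) = γ' s
    have h : ((w (1, s) : I) : ℝ) = (1 + s) / 2 := rfl
    by_cases hs : (s : ℝ) = 0
    · obtain rfl : s = 0 := Subtype.ext hs
      rw [Path.trans_apply, dif_pos (by rw [h, hs]; norm_num), γ'.source]
      convert γ.target
      rw [h, hs]; norm_num
    · have : (0 : ℝ) < s := lt_of_le_of_ne s.2.1 (Ne.symm hs)
      rw [Path.trans_apply, dif_neg (by rw [h]; linarith)]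
      congr 1
      exact Subtype.ext (by change 2 * _ - 1 = _; rw [h]; ring)
  · change (γ.trans γ') (w (s, s)) = γ.trans γ' s
    congr 1
    exact Subtype.ext (by simp [w])

theorem pathClass_symm {x y : E} (γ : Path x y) :
    pathClass (γ.symm : C(I, E)) = -pathClass (γ : C(I, E)) := by
  rw [eq_neg_iff_add_eq_zero, ← pathClass_trans, ← pathClass_const y]
  exact pathClass_eq_of_homotopicRel (Path.Homotopic.symm_trans γ)

/-- The action of a homeomorphism on singular chains. -/
def singularChainsMap (t : E ≃ₜ E) : singularChains E ⟶ singularChains E :=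
  SSet.chainsMap ℤ (X := TopCat.toSSet.obj (TopCat.of E)) (Y := TopCat.toSSet.obj (TopCat.of E))
    (TopCat.toSSet.map (TopCat.isoOfHomeo (X := TopCat.of E) (Y := TopCat.of E) t).hom)

/-- The action of a homeomorphism on `1`-chains modulo boundaries. -/
def opcyclesAction (t : E ≃ₜ E) :
    (singularChains E).opcycles 1 →ₗ[ℤ] (singularChains E).opcycles 1 :=
  (HomologicalComplex.opcyclesMap (singularChainsMap t) 1).hom

theorem opcyclesAction_pathClass (t : E ≃ₜ E) (f : C(I, E)) :
    opcyclesAction t (pathClass f) = pathClass ((t : C(E, E)).comp f) := by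
  rw [opcyclesAction, pathClass, ChainComplex.opcyclesMap_pOpcycles, singularChainsMap,
    SSet.chainsMap_simplexChain]
  rfl

theorem singularChainsMap_pointChain (t : E ≃ₜ E) (y : E) :
    ((singularChainsMap t).f 0).hom (pointChain y) = pointChain (t y) := by
  rw [singularChainsMap, pointChain, SSet.chainsMap_simplexChain]
  rfl

/-- The points form a basis of the `0`-chains. -/
def pointBasis (E : Type) [TopologicalSpace E] : Module.Basis E ℤ ((singularChains E).X 0) :=
  ((TopCat.toSSet.obj (TopCat.of E)).chainsBasis ℤ 0).reindex
    (TopCat.toSSetObj₀Equiv (X := TopCat.of E))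

theorem pointBasis_apply (y : E) : pointBasis E y = pointChain y := by
  rw [pointBasis, Module.Basis.reindex_apply, SSet.chainsBasis_apply]
  rfl

/-- A homeomorphism without finite orbits fixes no non-zero `0`-chain. -/
theorem eq_zero_of_singularChainsMap_eq (t : E ≃ₜ E)
    (ht : ∀ (n : ℤ) (e : E), (t ^ n) e = e → n = 0) (x : (singularChains E).X 0)
    (hx : ((singularChainsMap t).f 0).hom x = x) : x = 0 := by
  have hrepr (x : (singularChains E).X 0) :
      (pointBasis E).repr (((singularChainsMap t).f 0).hom x) =
        Finsupp.mapDomain t ((pointBasis E).repr x) := by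
    suffices h : (pointBasis E).repr.toLinearMap ∘ₗ ((singularChainsMap t).f 0).hom =
        Finsupp.lmapDomain ℤ ℤ t ∘ₗ (pointBasis E).repr.toLinearMap from LinearMap.congr_fun h x
    refine (pointBasis E).ext fun y => ?_
    rw [LinearMap.comp_apply, pointBasis_apply, singularChainsMap_pointChain, ← pointBasis_apply,
      ← pointBasis_apply]
    simp
  set c := (pointBasis E).repr x with hc
  have hct (y : E) : c (t y) = c y := by
    have h := hrepr x
    rw [hx, ← hc] at h
    conv_lhs => rw [h]
    exact Finsupp.mapDomain_apply t.injective c y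
  have hcn (n : ℕ) (y : E) : c ((t ^ n) y) = c y := by
    induction n with
    | zero => simp
    | succ n ih => rw [pow_succ']; exact (hct _).trans ih
  have : c = 0 := by
    by_contra hne
    obtain ⟨y, hy⟩ := Finsupp.ne_iff.1 hne
    refine Set.infinite_of_injective_forall_mem (f := fun n : ℕ => (t ^ n) y) (s := c.support)
      (fun m n hmn => ?_) (fun n => ?_) c.support.finite_toSet
    · have : (t ^ ((m : ℤ) - n)) ((t ^ n) y) = (t ^ n) y := by
        rw [← Homeomorph.mul_apply, ← zpow_natCast, ← zpow_add, sub_add_cancel, zpow_natCast]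
        exact hmn
      have := ht _ _ this
      omega
    · simpa [hcn] using hy
  exact (pointBasis E).repr.map_eq_zero_iff.1 this

/-- If the classes of all loops lie in a subgroup of the `1`-chains modulo boundaries, then so do
all homology classes: every `1`-cycle is, up to boundaries, a sum of loops. -/
theorem homologyι_mem_of_pathClass_mem [PathConnectedSpace E] (e : E)
    (B : Submodule ℤ ((singularChains E).opcycles 1))
    (hB : ∀ γ : Path e e, pathClass (γ : C(I, E)) ∈ B) (x : (singularChains E).homology 1) :
    ((singularChains E).homologyι 1).hom x ∈ B := by
  let ρ : (singularChains E).X 0 →ₗ[ℤ] (singularChains E).opcycles 1 :=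
    SSet.chainsDesc ℤ _ fun y => pathClass
      (PathConnectedSpace.somePath e (TopCat.toSSetObj₀Equiv (X := TopCat.of E) y) : C(I, E))
  have hρ (y : E) : ρ (pointChain y) = pathClass (PathConnectedSpace.somePath e y : C(I, E)) :=
    SSet.chainsDesc_simplexChain ..
  -- a chain differs from the sum of the chosen paths to the points of its boundary by loops
  suffices h : ∀ c : (singularChains E).X 1, ((singularChains E).pOpcycles 1).hom c -
      ρ (((singularChains E).d 1 0).hom c) ∈ B by
    obtain ⟨c, hc⟩ := ChainComplex.pOpcycles_surjective (singularChains E) 1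
      (((singularChains E).homologyι 1).hom x)
    have h0 := (ChainComplex.exact_homologyι_fromOpcycles
      (singularChains E) 0).apply_apply_eq_zero x
    have := h c
    rw [← ChainComplex.fromOpcycles_pOpcycles, hc, h0, map_zero, sub_zero] at this
    exact this
  suffices h : ⊤ ≤ B.comap (((singularChains E).pOpcycles 1).hom -
      ρ ∘ₗ ((singularChains E).d 1 0).hom) from fun c => h (Submodule.mem_top (x := c))
  rw [← ((TopCat.toSSet.obj (TopCat.of E)).chainsBasis ℤ 1).span_eq, Submodule.span_le]
  rintro _ ⟨s, rfl⟩
  rw [SSet.chainsBasis_apply, SetLike.mem_coe, Submodule.mem_comap]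
  obtain ⟨f, rfl⟩ := pathSimplex_surjective s
  rw [LinearMap.sub_apply, LinearMap.comp_apply, ← ChainComplex.fromOpcycles_pOpcycles]
  change pathClass f - ρ (((singularChains E).fromOpcycles 1 0).hom (pathClass f)) ∈ B
  rw [fromOpcycles_pathClass, map_sub, hρ, hρ]
  have h := hB (((PathConnectedSpace.somePath e (f 0)).trans ⟨f, rfl, rfl⟩).trans
    (PathConnectedSpace.somePath e (f 1)).symm)
  rw [pathClass_trans, pathClass_trans, pathClass_symm] at h
  convert h using 1
  change _ = _ + pathClass f + _
  abel

end PathClass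

/-! ### The deck transformation minus one -/

section DeckTransformation

namespace InfiniteCyclicCover

variable {X : Type} [TopologicalSpace X] (C : InfiniteCyclicCover X)

/-- The image of `t - 1` on `1`-chains of the cover modulo boundaries. -/
def augmentation : Submodule ℤ ((singularChains C.E).opcycles 1) :=
  LinearMap.range (opcyclesAction C.t - LinearMap.id)

theorem mkQ_pathClass_zpow (n : ℤ) (f : C(I, C.E)) :
    C.augmentation.mkQ (pathClass (((C.t ^ n : C.E ≃ₜ C.E) : C(C.E, C.E)).comp f)) =
      C.augmentation.mkQ (pathClass f) := by
  have h (f : C(I, C.E)) : C.augmentation.mkQ (pathClass ((C.t : C(C.E, C.E)).comp f)) =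
      C.augmentation.mkQ (pathClass f) := by
    rw [← sub_eq_zero, ← map_sub, Submodule.mkQ_apply, Submodule.Quotient.mk_eq_zero,
      ← opcyclesAction_pathClass]
    exact ⟨pathClass f, rfl⟩
  induction n with
  | zero => rfl
  | succ n ih =>
    rw [← ih, ← h (((C.t ^ (n : ℤ) : C.E ≃ₜ C.E) : C(C.E, C.E)).comp f),
      add_comm, zpow_add, zpow_one]
    rfl
  | pred n ih =>
    rw [← ih, ← h]
    congr 2
    ext x
    change C.t ((C.t ^ (-(n : ℤ) - 1)) (f x)) = (C.t ^ (-(n : ℤ))) (f x)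
    rw [← Homeomorph.mul_apply, ← zpow_one_add]
    congr 3
    ring

theorem proj_zpow (n : ℤ) (e : C.E) : C.proj ((C.t ^ n) e) = C.proj e := by
  induction n generalizing e with
  | zero => rfl
  | succ n ih => rw [zpow_add, zpow_one, Homeomorph.mul_apply, ih, C.proj_t]
  | pred n ih =>
    rw [← C.proj_t, ← Homeomorph.mul_apply, ← zpow_one_add, add_sub_cancel, ih]

/-- Two lifts of homotopic paths have the same class modulo boundaries and the image of `t - 1`. -/
theorem mkQ_pathClass_lift {γ γ' : C(I, X)} (h : γ.HomotopicRel γ' {0, 1}) {Γ Γ' : C(I, C.E)}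
    (hΓ : C.proj ∘ Γ = γ) (hΓ' : C.proj ∘ Γ' = γ') :
    C.augmentation.mkQ (pathClass Γ) = C.augmentation.mkQ (pathClass Γ') := by
  have h0 : γ 0 = C.proj (Γ 0) := (congrFun hΓ 0).symm
  have h1 : γ' 0 = C.proj (Γ' 0) := (congrFun hΓ' 0).symm
  have h01 : γ 0 = γ' 0 := h.some.fst_eq_snd (by simp)
  obtain ⟨n, hn⟩ := C.transitive (Γ 0) (Γ' 0) (by rw [← h0, ← h1, h01])
  rw [← C.mkQ_pathClass_zpow n Γ]
  congr 1
  have h2 : γ 0 = C.proj (Γ' 0) := h01.trans h1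
  have e1 : ((C.t ^ n : C.E ≃ₜ C.E) : C(C.E, C.E)).comp Γ = C.isCoveringMap.liftPath γ (Γ' 0) h2 :=
    (C.isCoveringMap.eq_liftPath_iff' h2).2 ⟨funext fun s => (C.proj_zpow n _).trans
      (congrFun hΓ s), hn⟩
  have e2 : Γ' = C.isCoveringMap.liftPath γ' (Γ' 0) h1 :=
    (C.isCoveringMap.eq_liftPath_iff' h1).2 ⟨hΓ', rfl⟩
  rw [e1]
  conv_rhs => rw [e2]
  exact pathClass_eq_of_homotopicRel (C.isCoveringMap.homotopicRel_liftPath h _ _ _)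

/-- Lifting paths defines a homomorphism from the fundamental group of the base to the `1`-chains
of the cover modulo boundaries and the image of `t - 1`. -/
theorem exists_lift_hom (x : X) : ∃ Φ : FundamentalGroup X x →*
    Multiplicative ((singularChains C.E).opcycles 1 ⧸ C.augmentation),
    ∀ (γ : Path x x) (Γ : C(I, C.E)), C.proj ∘ Γ = γ →
      Φ (.mk γ) = .ofAdd (C.augmentation.mkQ (pathClass Γ)) := by
  obtain ⟨e, he⟩ := C.surjective x
  have hlift (γ : Path x x) : ∃ Γ : C(I, C.E), C.proj ∘ Γ = γ ∧ Γ 0 = e :=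
    C.isCoveringMap.exists_path_lifts γ e (by simp [he])
  choose L hL hL0 using hlift
  choose r hr using Path.Homotopic.Quotient.mk_surjective (x₀ := x) (x₁ := x)
  -- any lift of any path in a homotopy class computes the value on that class
  let F : Path.Homotopic.Quotient x x → (singularChains C.E).opcycles 1 ⧸ C.augmentation :=
    fun g => C.augmentation.mkQ (pathClass (L (r g)))
  have hF (γ : Path x x) (Γ : C(I, C.E)) (hΓ : C.proj ∘ Γ = γ) :
      F (.mk γ) = C.augmentation.mkQ (pathClass Γ) :=
    C.mkQ_pathClass_lift (Path.Homotopic.Quotient.exact (hr _)) (hL _) hΓ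
  have hF_refl : F (.refl x) = 0 := by
    have h := hF (Path.refl x) (.const I e) (funext fun _ => he)
    rw [pathClass_const, map_zero] at h
    exact h
  have hF_trans (g g' : Path.Homotopic.Quotient x x) : F (g.trans g') = F g + F g' := by
    obtain ⟨γ, rfl⟩ := Path.Homotopic.Quotient.mk_surjective g
    obtain ⟨γ', rfl⟩ := Path.Homotopic.Quotient.mk_surjective g'
    obtain ⟨Γ', hΓ', h0⟩ := C.isCoveringMap.exists_path_lifts γ' (L γ 1)
      ((γ'.source.trans γ.target.symm).trans (congrFun (hL γ) 1).symm)
    let P : Path (L γ 0) (L γ 1) := ⟨L γ, rfl, rfl⟩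
    let P' : Path (L γ 1) (Γ' 1) := ⟨Γ', h0, rfl⟩
    rw [hF γ (L γ) (hL γ), hF γ' Γ' hΓ', ← map_add]
    refine (hF (γ.trans γ') (P.trans P' : C(I, C.E)) (funext fun s => ?_)).trans
      (congrArg C.augmentation.mkQ (pathClass_trans P P'))
    change C.proj ((P.trans P') s) = (γ.trans γ') s
    rw [Path.trans_apply, Path.trans_apply]
    split_ifs
    · exact congrFun (hL γ) _
    · exact congrFun hΓ' _
  refine ⟨{ toFun := fun g => .ofAdd (F g), map_one' := ?_, map_mul' := fun g g' => ?_ },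
    fun γ Γ hΓ => congrArg Multiplicative.ofAdd (hF γ Γ hΓ)⟩
  · exact congrArg Multiplicative.ofAdd hF_refl
  · refine congrArg Multiplicative.ofAdd ((hF_trans g' g).trans (add_comm _ _))

/-- The classes of loops of the cover lie in the image of `t - 1`, since they project to
commutators. -/
theorem pathClass_loop_mem {e : C.E} (γ : Path e e) :
    pathClass (γ : C(I, C.E)) ∈ C.augmentation := by
  obtain ⟨Φ, hΦ⟩ := C.exists_lift_hom (C.proj e)
  have h : FundamentalGroup.map C.proj e (.mk γ) ∈ commutator (FundamentalGroup X (C.proj e)) := by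
    rw [← C.range_map]
    exact ⟨_, rfl⟩
  have h1 := Abelianization.commutator_subset_ker Φ h
  have h2 := hΦ (γ.map C.proj.continuous) γ rfl
  rw [← Submodule.Quotient.mk_eq_zero]
  exact Multiplicative.ofAdd.injective (h2.symm.trans h1)

/-- `t - 1` is surjective on the first homology of the infinite cyclic cover. -/
theorem meridian_sub_one_surjective (a : H1 ℤ C.E) : ∃ b, C.meridian ℤ b - b = a := by
  obtain ⟨e⟩ : Nonempty C.E := inferInstance
  obtain ⟨o, ho⟩ := homologyι_mem_of_pathClass_mem e C.augmentation
    (fun γ => C.pathClass_loop_mem γ) a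
  replace ho : opcyclesAction C.t o - o = ((singularChains C.E).homologyι 1).hom a := ho
  -- `t - 1` is injective on `0`-chains, so that `o` is a cycle
  have hd : ((singularChains C.E).fromOpcycles 1 0).hom o = 0 := by
    refine eq_zero_of_singularChainsMap_eq C.t C.free _ ?_
    rw [← sub_eq_zero, ← ChainComplex.fromOpcycles_opcyclesMap, ← map_sub]
    refine (congrArg ((singularChains C.E).fromOpcycles 1 0).hom ho).trans ?_
    exact (ChainComplex.exact_homologyι_fromOpcycles (singularChains C.E) 0).apply_apply_eq_zero _
  obtain ⟨b, hb⟩ := (ChainComplex.exact_homologyι_fromOpcycles (singularChains C.E) 0 o).1 hd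
  refine ⟨b, ChainComplex.homologyι_injective (singularChains C.E) 1 ?_⟩
  rw [← ho, ← hb]
  refine (map_sub ((singularChains C.E).homologyι 1).hom _ _).trans ?_
  exact congrArg (· - _) (ChainComplex.homologyι_homologyMap (singularChainsMap C.t) 1 b)

end InfiniteCyclicCover
end DeckTransformation

end InfiniteCyclicCovers

/-! ### Fitting ideals -/

section Fitting

variable {R M : Type} [CommRing R] [AddCommGroup M] [Module R M]

theorem det_mem_initialFittingIdeal {n : ℕ} {x : Fin n → M} {A : Matrix (Fin n) (Fin n) R}
    (h : ∀ i, ∑ j, A i j • x j = 0) : A.det ∈ initialFittingIdeal (R := R) x :=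
  Ideal.subset_span ⟨A, h, rfl⟩

theorem initialFittingIdeal_le {n : ℕ} {x : Fin n → M} {I : Ideal R}
    (h : ∀ A : Matrix (Fin n) (Fin n) R, (∀ i, ∑ j, A i j • x j = 0) → A.det ∈ I) :
    initialFittingIdeal (R := R) x ≤ I :=
  Ideal.span_le.2 (by rintro _ ⟨A, hA, rfl⟩; exact h A hA)

theorem initialFittingIdeal_comp_equiv {n m : ℕ} (e : Fin n ≃ Fin m) (x : Fin m → M) :
    initialFittingIdeal (R := R) (x ∘ e) = initialFittingIdeal x := by
  refine le_antisymm (initialFittingIdeal_le fun A hA => ?_) (initialFittingIdeal_le fun A hA => ?_)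
  · rw [← Matrix.det_submatrix_equiv_self e.symm]
    refine det_mem_initialFittingIdeal fun i => ?_
    rw [← hA (e.symm i), ← e.sum_comp]
    simp
  · rw [← Matrix.det_submatrix_equiv_self e]
    refine det_mem_initialFittingIdeal fun i => ?_
    rw [← hA (e i), ← e.sum_comp]
    simp

theorem initialFittingIdeal_linearEquiv {M' : Type} [AddCommGroup M'] [Module R M']
    (e : M ≃ₗ[R] M') {n : ℕ} (x : Fin n → M) :
    initialFittingIdeal (R := R) (e ∘ x) = initialFittingIdeal x := by
  have h (A : Matrix (Fin n) (Fin n) R) (i : Fin n) :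
      ∑ j, A i j • (e ∘ x) j = 0 ↔ ∑ j, A i j • x j = 0 := by
    rw [← e.map_eq_zero_iff, map_sum]
    simp
  simp only [initialFittingIdeal, h]

/-- Adjoining a redundant generator does not change the initial Fitting ideal. -/
theorem initialFittingIdeal_cons {n : ℕ} {x : Fin n → M} {y : M}
    (hy : y ∈ Submodule.span R (Set.range x)) :
    initialFittingIdeal (R := R) (Fin.cons y x : Fin (n + 1) → M) = initialFittingIdeal x := by
  obtain ⟨c, rfl⟩ := (Submodule.mem_span_range_iff_exists_fun R).1 hy
  refine le_antisymm (initialFittingIdeal_le fun A hA => ?_) (initialFittingIdeal_le fun A hA => ?_)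
  · -- add multiples of the zeroth column to the others, then expand along the zeroth column
    let B : Matrix (Fin (n + 1)) (Fin (n + 1)) R :=
      .of fun i j => A i j + (Fin.cons 0 c : Fin (n + 1) → R) j * A i 0
    have hB : A.det = B.det := by
      rw [← Matrix.det_transpose A, ← Matrix.det_transpose B, eq_comm]
      exact Matrix.det_eq_of_forall_row_eq_smul_add_const (Fin.cons 0 c) 0 rfl fun i j => rfl
    rw [hB, Matrix.det_succ_column_zero]
    refine Ideal.sum_mem _ fun i _ => Ideal.mul_mem_left _ _
      (det_mem_initialFittingIdeal fun k => ?_)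
    have h := hA (i.succAbove k)
    rw [Fin.sum_univ_succ] at h
    simp only [Fin.cons_zero, Fin.cons_succ, Finset.smul_sum] at h
    rw [← h, ← Finset.sum_add_distrib]
    refine Finset.sum_congr rfl fun j _ => ?_
    simp only [Matrix.submatrix_apply, B, Matrix.of_apply, Fin.cons_succ, add_smul, mul_smul]
    rw [add_comm, smul_comm]
  · let B : Matrix (Fin (n + 1)) (Fin (n + 1)) R :=
      .of (Fin.cons (Fin.cons (-1) c) fun i => Fin.cons 0 (A i))
    have hB : B.det = -A.det := by
      rw [Matrix.det_succ_column_zero, Fin.sum_univ_succ]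
      have h : B.submatrix (Fin.succAbove 0) Fin.succ = A := by
        ext i j
        simp [B]
      rw [h]
      simp [B]
    rw [← neg_mem_iff, ← hB]
    refine det_mem_initialFittingIdeal fun i => ?_
    refine Fin.cases ?_ (fun i => ?_) i
    · simp [Fin.sum_univ_succ, B]
    · simpa [Fin.sum_univ_succ, B] using hA i

theorem initialFittingIdeal_append {n m : ℕ} {x : Fin n → M} (y : Fin m → M)
    (hx : Submodule.span R (Set.range x) = ⊤) :
    initialFittingIdeal (R := R) (Fin.append y x) = initialFittingIdeal x := by
  induction m with
  | zero =>
    rw [show y = Fin.elim0 from Subsingleton.elim _ _, Fin.elim0_append]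
    exact initialFittingIdeal_comp_equiv (finCongr (Nat.zero_add n)) x
  | succ m ih =>
    rw [← ih (Fin.tail y), ← initialFittingIdeal_cons (x := Fin.append (Fin.tail y) x) (y := y 0),
      ← Fin.cons_self_tail y, Fin.append_cons]
    · exact initialFittingIdeal_comp_equiv (finCongr (Nat.add_right_comm m 1 n))
        (Fin.cons _ (Fin.append _ x))
    · have : Set.range x ⊆ Set.range (Fin.append (Fin.tail y) x) := by
        rintro _ ⟨i, rfl⟩
        exact ⟨Fin.natAdd m i, Fin.append_right _ _ i⟩
      exact Submodule.span_mono this (by rw [hx]; exact Submodule.mem_top)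

/-- Fitting's lemma: the initial Fitting ideal depends on the module only. -/
theorem initialFittingIdeal_eq {n m : ℕ} {x : Fin n → M} {y : Fin m → M}
    (hx : Submodule.span R (Set.range x) = ⊤) (hy : Submodule.span R (Set.range y) = ⊤) :
    initialFittingIdeal (R := R) x = initialFittingIdeal y := by
  rw [← initialFittingIdeal_append y hx, ← initialFittingIdeal_append x hy,
    ← initialFittingIdeal_comp_equiv finAddFlip]
  congr 1
  ext i
  refine Fin.addCases (fun i => ?_) (fun i => ?_) i <;> simp

/-- The initial Fitting ideal of a finite product of cyclic modules. -/
theorem initialFittingIdeal_pi_quotient {n : ℕ} (f : Fin n → R) :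
    initialFittingIdeal (R := R)
      (fun i => (Pi.single i 1 : ∀ i, R ⧸ Ideal.span {f i})) = Ideal.span {∏ i, f i} := by
  have key (c : Fin n → R) : ∑ j, c j • (Pi.single j 1 : ∀ i, R ⧸ Ideal.span {f i}) = 0 ↔
      ∀ j, f j ∣ c j := by
    rw [funext_iff]
    refine forall_congr' fun k => ?_
    rw [Finset.sum_apply, Finset.sum_eq_single k (by intro j _ hj; simp [hj.symm]) (by simp)]
    simp [← Ideal.mem_span_singleton, ← Ideal.Quotient.eq_zero_iff_mem, Algebra.smul_def]
  refine le_antisymm (initialFittingIdeal_le fun A hA => ?_) ?_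
  · rw [Ideal.mem_span_singleton]
    choose B hB using fun i j => (key _).1 (hA i) j
    have : A = (Matrix.of B) * Matrix.diagonal f := by
      ext i j
      rw [Matrix.mul_diagonal, hB i j, mul_comm]; rfl
    rw [this, Matrix.det_mul, Matrix.det_diagonal]
    exact dvd_mul_left _ _
  · rw [Ideal.span_singleton_le_iff_mem, ← Matrix.det_diagonal]
    refine det_mem_initialFittingIdeal fun i => (key _).2 fun j => ?_
    rcases eq_or_ne i j with rfl | h
    · simp
    · simp [h]

/-- The initial Fitting ideal annihilates the module. -/
theorem smul_eq_zero_of_mem_initialFittingIdeal {n : ℕ} {x : Fin n → M}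
    (hx : Submodule.span R (Set.range x) = ⊤) {d : R} (hd : d ∈ initialFittingIdeal (R := R) x)
    (a : M) : d • a = 0 := by
  suffices h : initialFittingIdeal (R := R) x ≤ Module.annihilator R M from
    Module.mem_annihilator.1 (h hd) a
  refine initialFittingIdeal_le fun A hA => Module.mem_annihilator.2 fun a => ?_
  have ha : a ∈ Submodule.span R (Set.range x) := hx ▸ Submodule.mem_top
  obtain ⟨c, rfl⟩ := (Submodule.mem_span_range_iff_exists_fun R).1 ha
  have h (k : Fin n) : A.det • x k = 0 := by
    calc A.det • x k = ∑ j, (A.adjugate * A) k j • x j := by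
          rw [Matrix.adjugate_mul, Finset.sum_eq_single k]
          · simp
          · intro j _ hj; simp [hj.symm]
          · simp
      _ = ∑ i, A.adjugate k i • ∑ j, A i j • x j := by
          simp only [Matrix.mul_apply, Finset.sum_smul, Finset.smul_sum, mul_smul]
          exact Finset.sum_comm
      _ = 0 := by simp [hA]
  rw [Finset.smul_sum]
  exact Finset.sum_eq_zero fun k _ => by rw [smul_comm, h, smul_zero]

end Fitting

/-- A multilinear map takes its values in a submodule as soon as it does so on a spanning set. -/
theorem MultilinearMap.map_mem_of_mem_span {K ι M N : Type*} [CommSemiring K] [AddCommMonoid M]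
    [AddCommMonoid N] [Module K M] [Module K N] [Fintype ι]
    (f : MultilinearMap K (fun _ : ι => M) N) {S : Set M} {J : Submodule K N}
    (h : ∀ m : ι → M, (∀ i, m i ∈ S) → f m ∈ J) (m : ι → M)
    (hm : ∀ i, m i ∈ Submodule.span K S) : f m ∈ J := by
  classical
  suffices H : ∀ (s : Finset ι) (m : ι → M), (∀ i ∈ s, m i ∈ Submodule.span K S) →
      (∀ i ∉ s, m i ∈ S) → f m ∈ J from H Finset.univ m (fun i _ => hm i) (by simp)
  intro s
  induction s using Finset.induction_on with
  | empty => exact fun m _ hm => h m fun i => hm i (by simp)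
  | insert k s hk ih =>
    intro m hm hm'
    suffices H : ∀ v ∈ Submodule.span K S, f (Function.update m k v) ∈ J by
      simpa using H (m k) (hm k (by simp))
    intro v hv
    induction hv using Submodule.span_induction with
    | mem v hv =>
      refine ih _ (fun i hi => ?_) fun i hi => ?_
      · rw [Function.update_of_ne (by rintro rfl; exact hk hi)]
        exact hm i (by simp [hi])
      · rcases eq_or_ne i k with rfl | hik
        · simpa using hv
        · rw [Function.update_of_ne hik]
          exact hm' i (by simp [hik, hi])
    | zero => simp
    | add v w _ _ hv hw => rw [f.map_update_add]; exact J.add_mem hv hw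
    | smul c v _ hv => rw [f.map_update_smul]; exact J.smul_mem c hv

/-- If all matrices with rows in `S` have their determinant in an ideal, then so have all matrices
with rows in the span of `S` over a subring. -/
theorem Matrix.det_mem_of_row_mem_span (K : Type*) {R ι : Type*} [CommRing K] [CommRing R]
    [Algebra K R] [Fintype ι] [DecidableEq ι] {S : Set (ι → R)} {J : Ideal R}
    (h : ∀ A : Matrix ι ι R, (∀ i, A i ∈ S) → A.det ∈ J) (A : Matrix ι ι R)
    (hA : ∀ i, A i ∈ Submodule.span K S) : A.det ∈ J :=
  MultilinearMap.map_mem_of_mem_span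
    ((Matrix.detRowAlternating (n := ι) (R := R)).toMultilinearMap.restrictScalars K)
    (J := J.restrictScalars K) h A hA

/-! ### Greatest common divisors of ideals of integral Laurent polynomials -/

section GCD

theorem toLaurent_mul_T_mem_iff {R : Type} [CommRing R] {I : Ideal R[T;T⁻¹]} {a : R[T;T⁻¹]}
    (n : ℤ) :
    a * T n ∈ I ↔ a ∈ I := by
  refine ⟨fun h => ?_, fun h => I.mul_mem_right _ h⟩
  have := I.mul_mem_right (T (-n)) h
  rwa [mul_assoc, ← T_add, add_neg_cancel, T_zero, mul_one] at this

theorem dvd_of_toLaurent_dvd_toLaurent {R : Type} [CommRing R] {p q : R[X]}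
    (h : toLaurent p ∣ toLaurent q) : ∃ k : ℕ, p ∣ X ^ k * q := by
  obtain ⟨b, hb⟩ := h
  obtain ⟨k, c, hc⟩ := exists_T_pow b
  refine ⟨k, c, toLaurent_injective ?_⟩
  rw [map_mul, map_mul, hb, hc, toLaurent_X_pow]
  ring

/-- Over a field, a factor `X ^ k` may be cancelled from a divisibility when the divisor does not
vanish at zero. -/
theorem dvd_of_dvd_X_pow_mul {K : Type*} [Field K] {p q : K[X]} {k : ℕ} (hp : p.coeff 0 ≠ 0)
    (h : p ∣ X ^ k * q) : p ∣ q := by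
  refine IsCoprime.dvd_of_dvd_mul_left (IsCoprime.pow_right ?_) h
  rw [isCoprime_comm]
  exact (irreducible_X.coprime_iff_not_dvd).2 (by rwa [X_dvd_iff])

/-- A nonzero polynomial over the fraction field of a GCD domain is, up to a constant, the image of
a primitive polynomial. -/
theorem exists_isPrimitive_map_eq_C_mul {O K : Type*} [CommRing O] [IsDomain O] [IsGCDMonoid O]
    [Field K] [Algebra O K] [IsFractionRing O K] {f : K[X]} (hf : f ≠ 0) :
    ∃ g : O[X], g.IsPrimitive ∧ ∃ c : K, c ≠ 0 ∧ g.map (algebraMap O K) = Polynomial.C c * f := by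
  have : Nonempty (NormalizedGCDMonoid O) := inferInstance
  obtain ⟨_⟩ := this
  obtain ⟨b, hb, h⟩ := IsLocalization.integerNormalization_spec (nonZeroDivisors O) f
  set q := IsLocalization.integerNormalization (nonZeroDivisors O) f
  have hq : q ≠ 0 := by
    rwa [Ne, IsFractionRing.integerNormalization_eq_zero_iff]
  have hc : algebraMap O K q.content ≠ 0 := by
    rwa [Ne, FaithfulSMul.algebraMap_eq_zero_iff, content_eq_zero_iff]
  have hb0 : algebraMap O K b ≠ 0 := by
    rw [Ne, FaithfulSMul.algebraMap_eq_zero_iff]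
    exact nonZeroDivisors.ne_zero hb
  refine ⟨q.primPart, q.isPrimitive_primPart, algebraMap O K b / algebraMap O K q.content,
    div_ne_zero hb0 hc, ?_⟩
  have h2 := congrArg (Polynomial.map (algebraMap O K)) q.eq_C_content_mul_primPart
  rw [Polynomial.map_mul, Polynomial.map_C, h, ← algebraMap_smul K b f,
    Polynomial.smul_eq_C_mul] at h2
  rw [div_eq_inv_mul, Polynomial.C_mul, mul_assoc, h2, ← mul_assoc, ← Polynomial.C_mul,
    inv_mul_cancel₀ hc, Polynomial.C_1, one_mul]

/-- A greatest common divisor of an ideal of `ℤ[t, t⁻¹]` generates this ideal up to integers: the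
quotients of the elements of the ideal by it generate the unit ideal over `ℚ`, for otherwise they
would have a common divisor over `ℚ`, and by Gauss's lemma also one over `ℤ`. -/
theorem IsGCDOfIdeal.exists_int_mul_mem {I : Ideal ℤ[T;T⁻¹]} {Δ : ℤ[X]} (h0 : Δ ≠ 0)
    (h : IsGCDOfIdeal I (toLaurent Δ)) :
    ∃ m : ℤ, m ≠ 0 ∧ toLaurent (Polynomial.C m * Δ) ∈ I := by
  -- the ideal of all quotients
  let J : Ideal ℤ[X] := I.comap (toLaurent (R := ℤ)) |>.colon {Δ}
  have hJ (q : ℤ[X]) : q ∈ J ↔ toLaurent (q * Δ) ∈ I := by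
    simp [J, Submodule.mem_colon_singleton]
  let φ : ℤ[X] →+* ℚ[X] := Polynomial.mapRingHom (Int.castRingHom ℚ)
  obtain ⟨δ', hδ'⟩ : ∃ δ', J.map φ = Ideal.span {δ'} := (IsPrincipalIdealRing.principal _).1
  have hmem (q : ℤ[X]) : φ q ∈ J.map φ ↔ ∃ m : ℤ, m ≠ 0 ∧ Polynomial.C m * q ∈ J := by
    let : Algebra ℤ[X] ℚ[X] := Polynomial.algebra ℤ ℚ
    have := Polynomial.isLocalization (nonZeroDivisors ℤ) ℚ
    have := IsLocalization.algebraMap_mem_map_algebraMap_iff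
      ((nonZeroDivisors ℤ).map (Polynomial.C : ℤ →+* ℤ[X])) ℚ[X] J q
    simpa [Submonoid.mem_map, φ] using this
  have hne : δ' ≠ 0 := by
    rintro rfl
    have hJ0 (q : ℤ[X]) (hq : q ∈ J) : q = 0 := by
      have := Ideal.mem_map_of_mem φ hq
      rw [hδ', Ideal.mem_span_singleton, zero_dvd_iff] at this
      exact (Polynomial.map_eq_zero_iff (Int.cast_injective (α := ℚ))).1 this
    have h00 : (0 : ℤ[T;T⁻¹]) ∣ toLaurent Δ := by
      refine h.2 _ fun a ha => ?_
      obtain ⟨b, rfl⟩ := h.1 a ha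
      obtain ⟨k, c, hc⟩ := exists_T_pow b
      have hc' : c ∈ J := by
        rw [hJ, map_mul, hc, mul_right_comm, toLaurent_mul_T_mem_iff, mul_comm]
        exact ha
      have hb : b * T (k : ℤ) = 0 := by rw [← hc, hJ0 c hc', map_zero]
      have hb' : b = b * T (k : ℤ) * T (-k : ℤ) := by
        rw [mul_assoc, ← T_add, add_neg_cancel, T_zero, mul_one]
      rw [hb', hb]
      simp
    rw [zero_dvd_iff] at h00
    exact h0 (toLaurent_injective (h00.trans (map_zero _).symm))
  obtain ⟨δ, hδp, u, hu, hδ⟩ := exists_isPrimitive_map_eq_C_mul (O := ℤ) hne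
  change φ δ = _ at hδ
  have hspan : J.map φ = Ideal.span {φ δ} := by
    rw [hδ', hδ, Ideal.span_singleton_eq_span_singleton]
    exact (associated_unit_mul_left _ _ (Polynomial.isUnit_C.2 hu.isUnit)).symm
  have hdvd (q : ℤ[X]) (hq : q ∈ J) : δ ∣ q := by
    rw [Polynomial.IsPrimitive.Int.dvd_iff_map_cast_dvd_map_cast _ _ hδp]
    have := Ideal.mem_map_of_mem φ hq
    rwa [hspan, Ideal.mem_span_singleton] at this
  have hunit : toLaurent (δ * Δ) ∣ toLaurent Δ := by
    refine h.2 _ fun a ha => ?_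
    obtain ⟨b, rfl⟩ := h.1 a ha
    obtain ⟨k, c, hc⟩ := exists_T_pow b
    have hc' : c ∈ J := by
      rw [hJ, map_mul, hc, mul_right_comm, toLaurent_mul_T_mem_iff, mul_comm]
      exact ha
    obtain ⟨d, rfl⟩ := hdvd c hc'
    refine ⟨toLaurent d * T (-k), ?_⟩
    have : b = toLaurent (δ * d) * T (-k) := by
      rw [hc, mul_assoc, ← T_add, add_neg_cancel, T_zero, mul_one]
    rw [this, map_mul, map_mul]
    ring
  obtain ⟨k, c, hc⟩ := dvd_of_toLaurent_dvd_toLaurent hunit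
  have hc1 : δ ∣ X ^ k := ⟨c, mul_right_cancel₀ h0 (by rw [hc]; ring)⟩
  have h1 : φ (X ^ k) ∈ J.map φ := by
    rw [hspan, Ideal.mem_span_singleton]
    exact map_dvd φ hc1
  obtain ⟨m, hm, hmJ⟩ := (hmem _).1 h1
  refine ⟨m, hm, ?_⟩
  rw [hJ, mul_right_comm, map_mul, toLaurent_X_pow, toLaurent_mul_T_mem_iff] at hmJ
  exact hmJ

end GCD

/-! ### The Alexander polynomial over a field of characteristic zero -/

section BaseChange

variable {A : Type} [AddCommGroup A] [Module ℤ[T;T⁻¹] A] {K : Type} [Field K]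
  {N : Type} [AddCommGroup N] [Module K[X] N]

local notation "ψ" => Polynomial.map (Int.castRingHom K)

theorem map_toLaurent_smul {j : A →+ N}
    (hj : ∀ a, j ((T 1 : ℤ[T;T⁻¹]) • a) = (X : K[X]) • j a) (q : ℤ[X]) (a : A) :
    j (toLaurent q • a) = ψ q • j a := by
  induction q using Polynomial.induction_on' generalizing a with
  | add p q hp hq => rw [map_add, add_smul, map_add, hp, hq, Polynomial.map_add, add_smul]
  | monomial k c =>
    induction k generalizing a with
    | zero =>
      simp [Int.cast_smul_eq_zsmul]
    | succ k ih =>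
      rw [← monomial_mul_X, map_mul, toLaurent_X, mul_smul, ih, hj, Polynomial.map_mul, map_X,
        mul_smul]

/-- The initial Fitting ideal of the base change contains, up to powers of `t`, the image of the
initial Fitting ideal of the original module. -/
theorem exists_map_mem_initialFittingIdeal {j : A →+ N}
    (hj : ∀ a, j ((T 1 : ℤ[T;T⁻¹]) • a) = (X : K[X]) • j a) {n : ℕ} (x : Fin n → A)
    {a : ℤ[T;T⁻¹]} (ha : a ∈ initialFittingIdeal (R := ℤ[T;T⁻¹]) x) :
    ∃ (k : ℕ) (q : ℤ[X]), toLaurent q = a * T k ∧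
      ψ q ∈ initialFittingIdeal (R := K[X]) fun i => j (x i) := by
  induction ha using Submodule.span_induction with
  | mem d hd =>
    obtain ⟨B, hB, rfl⟩ := hd
    choose k q hq using fun i l => exists_T_pow (B i l)
    obtain ⟨M, hM⟩ : ∃ M : ℕ, ∀ i l, k i l ≤ M :=
      ⟨∑ i, ∑ l, k i l, fun i l =>
        (Finset.single_le_sum (f := k i) (fun _ _ => Nat.zero_le _) (Finset.mem_univ l)).trans
        (Finset.single_le_sum (f := fun i => ∑ l, k i l) (fun _ _ => Nat.zero_le _)
          (Finset.mem_univ i))⟩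
    let Q : Matrix (Fin n) (Fin n) ℤ[X] := Matrix.of fun i l => q i l * X ^ (M - k i l)
    have hQ : toLaurent.mapMatrix Q = (T (M : ℤ) : ℤ[T;T⁻¹]) • B := by
      ext1 i l
      have : (k i l : ℤ) + ((M - k i l : ℕ) : ℤ) = M := by
        have := hM i l
        omega
      simp only [Q, Matrix.of_apply, RingHom.mapMatrix_apply, Matrix.map_apply, map_mul,
        toLaurent_X_pow, hq, Matrix.smul_apply, smul_eq_mul]
      rw [mul_assoc, ← T_add, this, mul_comm]
    refine ⟨M * n, Q.det, ?_, ?_⟩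
    · rw [RingHom.map_det, hQ, Matrix.det_smul, Fintype.card_fin, T_pow, mul_comm]
      push_cast
      rw [mul_comm (M : ℤ)]
    · have : ψ Q.det = ((Polynomial.mapRingHom (Int.castRingHom K)).mapMatrix Q).det :=
        RingHom.map_det (Polynomial.mapRingHom (Int.castRingHom K)) Q
      rw [this]
      refine det_mem_initialFittingIdeal fun i => ?_
      have h1 : ∑ l, toLaurent (Q i l) • x l = 0 := by
        have (l : Fin n) : toLaurent (Q i l) = T (M : ℤ) * B i l := congrFun (congrFun hQ i) l
        simp_rw [this, mul_smul, ← Finset.smul_sum, hB, smul_zero]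
      have h2 := congrArg j h1
      rw [map_sum, map_zero] at h2
      rw [← h2]
      exact Finset.sum_congr rfl fun l _ => (map_toLaurent_smul hj _ _).symm
  | zero => exact ⟨0, 0, by simp, by simp⟩
  | add a b _ _ ha hb =>
    obtain ⟨k, p, hp, hp'⟩ := ha
    obtain ⟨l, q, hq, hq'⟩ := hb
    refine ⟨k + l, p * X ^ l + q * X ^ k, ?_, ?_⟩
    · rw [map_add, map_mul, map_mul, hp, hq, toLaurent_X_pow, toLaurent_X_pow, mul_assoc, mul_assoc,
        ← T_add, ← T_add, add_mul]
      push_cast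
      rw [add_comm (l : ℤ)]
    · rw [Polynomial.map_add, Polynomial.map_mul, Polynomial.map_mul]
      exact Ideal.add_mem _ (Ideal.mul_mem_right _ _ hp') (Ideal.mul_mem_right _ _ hq')
  | smul r a _ ha =>
    obtain ⟨k, p, hp, hp'⟩ := ha
    obtain ⟨l, q, hq⟩ := exists_T_pow r
    refine ⟨k + l, q * p, ?_, ?_⟩
    · rw [map_mul, hp, hq, smul_eq_mul]
      push_cast
      rw [T_add]
      ring
    · rw [Polynomial.map_mul]
      exact Ideal.mul_mem_left _ _ hp'

variable [Module K N] [IsScalarTower K K[X] N]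

/-- The images of generators of a module over `ℤ[t, t⁻¹]` generate its base change to a field over
`K[t]` already, if a polynomial which does not vanish at zero kills the base change. -/
theorem span_range_map_eq_top {j : A →+ N}
    (hj : ∀ a, j ((T 1 : ℤ[T;T⁻¹]) • a) = (X : K[X]) • j a)
    (hspan : Submodule.span K (Set.range j) = ⊤) {D : K[X]} (hD : D.coeff 0 ≠ 0)
    (hkill : ∀ v : N, D • v = 0) {n : ℕ} {x : Fin n → A}
    (hx : Submodule.span ℤ[T;T⁻¹] (Set.range x) = ⊤) :
    Submodule.span K[X] (Set.range fun i => j (x i)) = ⊤ := by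
  set S := Submodule.span K[X] (Set.range fun i => j (x i))
  have hS (k : ℕ) (w : N) (hw : (X ^ k : K[X]) • w ∈ S) : w ∈ S := by
    have hc : IsCoprime D (X ^ k) := by
      refine IsCoprime.pow_right ?_
      rw [isCoprime_comm]
      exact (irreducible_X.coprime_iff_not_dvd).2 (by rwa [X_dvd_iff])
    obtain ⟨u, v, huv⟩ := hc
    have : w = v • (X ^ k : K[X]) • w := by
      conv_lhs => rw [← one_smul K[X] w, ← huv, add_smul, mul_smul, hkill, smul_zero, zero_add,
        mul_smul]
    rw [this]
    exact S.smul_mem _ hw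
  have hA (a : A) : j a ∈ S := by
    have ha : a ∈ Submodule.span ℤ[T;T⁻¹] (Set.range x) := hx ▸ Submodule.mem_top
    induction ha using Submodule.span_induction with
    | mem y hy =>
      obtain ⟨i, rfl⟩ := hy
      exact Submodule.subset_span ⟨i, rfl⟩
    | zero => simp
    | add y z _ _ hy hz => rw [map_add]; exact S.add_mem hy hz
    | smul r y _ hy =>
      obtain ⟨k, q, hq⟩ := exists_T_pow r
      refine hS k _ ?_
      have h1 := map_toLaurent_smul (K := K) hj (X ^ k) (r • y)
      rw [toLaurent_X_pow, ← mul_smul, mul_comm, ← hq, map_toLaurent_smul hj, Polynomial.map_pow,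
        map_X] at h1
      rw [← h1]
      exact S.smul_mem _ hy
  rw [eq_top_iff]
  intro v _
  have hv : v ∈ Submodule.span K (Set.range j) := hspan ▸ Submodule.mem_top
  refine (Submodule.span_le (p := S.restrictScalars K)).2 ?_ hv
  rintro _ ⟨a, rfl⟩
  exact hA a

/-- Since `K` is flat over `ℤ`, the relations over `K[t]` among the images of elements `x i` in the
base change to `K` are the `K`-linear combinations of the relations over `ℤ[t]` among the `x i`. -/
theorem relation_mem_span [Module.Flat ℤ K] {j : A →ₗ[ℤ] N}
    (hj : ∀ a, j ((T 1 : ℤ[T;T⁻¹]) • a) = (X : K[X]) • j a) (hK : IsBaseChange K j)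
    {n : ℕ} (x : Fin n → A) (r : Fin n → K[X]) (hr : ∑ i, r i • j (x i) = 0) :
    r ∈ Submodule.span K {s : Fin n → K[X] | ∃ q : Fin n → ℤ[X],
      (∑ i, toLaurent (q i) • x i = 0) ∧ s = fun i => ψ (q i)} := by
  let π : (Fin n → ℤ[X]) →ₗ[ℤ] A := AddMonoidHom.toIntLinearMap
    { toFun := fun q => ∑ i, toLaurent (q i) • x i
      map_zero' := by simp
      map_add' := by simp [add_smul, Finset.sum_add_distrib] }
  let m : (Fin n → ℤ[X]) →ₗ[ℤ] (Fin n → K[X]) := AddMonoidHom.toIntLinearMap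
    { toFun := fun q i => ψ (q i)
      map_zero' := by ext1; simp
      map_add' := fun p q => by ext1; simp }
  let θ : TensorProduct ℤ K (Fin n → ℤ[X]) →ₗ[K] (Fin n → K[X]) :=
    (TensorProduct.isBaseChange ℤ (Fin n → ℤ[X]) K).lift m
  have hθ (c : K) (q : Fin n → ℤ[X]) : θ (c ⊗ₜ q) = c • m q := by
    have : c ⊗ₜ[ℤ] q = c • (1 : K) ⊗ₜ[ℤ] q := by
      rw [TensorProduct.smul_tmul', smul_eq_mul, mul_one]
    rw [this, map_smul]
    congr 1
    exact (TensorProduct.isBaseChange ℤ (Fin n → ℤ[X]) K).lift_eq m q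
  have hsurj : Function.Surjective θ := by
    rw [← LinearMap.range_eq_top, eq_top_iff]
    rintro r -
    have : r = ∑ i, ∑ k ∈ (r i).support, (r i).coeff k • m (Pi.single i (X ^ k)) := by
      ext1 l
      rw [Finset.sum_apply, Finset.sum_eq_single l]
      · conv_lhs => rw [(r l).as_sum_support_C_mul_X_pow]
        simp [m, Polynomial.smul_eq_C_mul]
      · intro i _ hi
        simp [m, Pi.single_eq_of_ne hi.symm]
      · simp
    rw [this]
    refine Submodule.sum_mem _ fun i _ => Submodule.sum_mem _ fun k _ => ?_
    exact ⟨_ ⊗ₜ _, hθ _ _⟩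
  obtain ⟨z, rfl⟩ := hsurj r
  have hz : (LinearMap.lTensor K π) z = 0 := by
    refine hK.equiv.injective ?_
    rw [map_zero, ← hr]
    clear hr
    induction z with
    | zero => simp
    | add z w hz hw => simp [hz, hw, add_smul, Finset.sum_add_distrib]
    | tmul c q =>
      rw [LinearMap.lTensor_tmul, IsBaseChange.equiv_tmul, hθ]
      simp only [π, m, AddMonoidHom.coe_toIntLinearMap, AddMonoidHom.coe_mk, ZeroHom.coe_mk,
        map_sum, Pi.smul_apply, Finset.smul_sum, smul_assoc]
      refine Finset.sum_congr rfl fun i _ => ?_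
      congr 1
      exact map_toLaurent_smul (j := j.toAddMonoidHom) hj (q i) (x i)
  have hex := Module.Flat.lTensor_exact K (LinearMap.exact_subtype_ker_map π)
  obtain ⟨w, rfl⟩ := (hex z).1 hz
  clear hr hz
  induction w with
  | zero => simp
  | add z w hz hw => rw [map_add, map_add]; exact Submodule.add_mem _ hz hw
  | tmul c q =>
    rw [LinearMap.lTensor_tmul, hθ]
    exact Submodule.smul_mem _ _ (Submodule.subset_span ⟨q.1, q.2, rfl⟩)

/-- The initial Fitting ideal of the base change to a field of characteristic zero consists of
multiples of the Alexander polynomial. -/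
theorem initialFittingIdeal_map_le [CharZero K] [Module.Flat ℤ K] {j : A →ₗ[ℤ] N}
    (hj : ∀ a, j ((T 1 : ℤ[T;T⁻¹]) • a) = (X : K[X]) • j a) (hK : IsBaseChange K j)
    {n : ℕ} {x : Fin n → A} {Δ : ℤ[X]} (h0 : Δ.coeff 0 ≠ 0)
    (hΔ : ∀ a ∈ initialFittingIdeal (R := ℤ[T;T⁻¹]) x, toLaurent Δ ∣ a) :
    (initialFittingIdeal (R := K[X]) fun i => j (x i)) ≤ Ideal.span {ψ Δ} := by
  refine initialFittingIdeal_le fun B hB =>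
    Matrix.det_mem_of_row_mem_span K (fun C hC => ?_) B
      fun i => relation_mem_span hj hK x (B i) (hB i)
  choose q hq hC using hC
  let Q : Matrix (Fin n) (Fin n) ℤ[X] := Matrix.of q
  have h1 : toLaurent Q.det ∈ initialFittingIdeal (R := ℤ[T;T⁻¹]) x := by
    rw [RingHom.map_det]
    exact det_mem_initialFittingIdeal hq
  have h2 : C.det = ψ Q.det := by
    have : C = (Polynomial.mapRingHom (Int.castRingHom K)).mapMatrix Q := by
      ext1 i l
      exact congrFun (hC i) l
    rw [this]
    exact (RingHom.map_det (Polynomial.mapRingHom (Int.castRingHom K)) Q).symm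
  obtain ⟨k, hk⟩ := dvd_of_toLaurent_dvd_toLaurent (hΔ _ h1)
  rw [h2, Ideal.mem_span_singleton]
  refine dvd_of_dvd_X_pow_mul (k := k) (by simpa using h0) ?_
  have := Polynomial.map_dvd (Int.castRingHom K) hk
  rwa [Polynomial.map_mul, Polynomial.map_pow, map_X] at this

end BaseChange

/-! ### The base change as a sum of cyclic modules -/

section Structure

/-- A finitely generated torsion module over `K[t]` is a finite product of modules `K[t] ⧸ (f i)`
with monic `f i`. -/
theorem exists_linearEquiv_pi_adjoinRoot {K : Type} [Field K] {N : Type} [AddCommGroup N]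
    [Module K[X] N] [Module.Finite K[X] N] (hN : Module.IsTorsion K[X] N) :
    ∃ (r : ℕ) (f : Fin r → K[X]), (∀ i, (f i).Monic) ∧
      Nonempty (N ≃ₗ[K[X]] ∀ i, K[X] ⧸ Ideal.span {f i}) := by
  classical
  obtain ⟨κ, _, p, hp, e, ⟨E⟩⟩ := Module.equiv_directSum_of_isTorsion hN
  let σ := (Fintype.equivFin κ).symm
  have hne (i : κ) : p i ^ e i ≠ 0 := pow_ne_zero _ (hp i).ne_zero
  refine ⟨Fintype.card κ, fun i => normalize (p (σ i) ^ e (σ i)),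
    fun i => Polynomial.monic_normalize (hne _), ⟨?_⟩⟩
  refine E ≪≫ₗ DirectSum.linearEquivFunOnFintype _ _ _ ≪≫ₗ
    (LinearEquiv.piCongrLeft K[X] (fun i => K[X] ⧸ Ideal.span {p i ^ e i}) σ).symm ≪≫ₗ
    LinearEquiv.piCongrRight fun i => Submodule.quotEquivOfEq _ _ ?_
  exact Ideal.span_singleton_eq_span_singleton.2 (associated_normalize _)

theorem span_range_single_quotient {R : Type*} [CommRing R] {r : ℕ} (f : Fin r → R) :
    Submodule.span R
      (Set.range fun i => (Pi.single i 1 : ∀ i, R ⧸ Ideal.span {f i})) = ⊤ := by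
  rw [eq_top_iff]
  intro v _
  rw [← Finset.univ_sum_single v]
  refine Submodule.sum_mem _ fun i _ => ?_
  obtain ⟨q, hq⟩ := Ideal.Quotient.mk_surjective (v i)
  have : (Pi.single i (v i) : ∀ i, R ⧸ Ideal.span {f i}) = q • Pi.single i 1 := by
    rw [← Pi.single_smul, ← hq]
    congr 1
    exact congrArg (Ideal.Quotient.mk _) (mul_one q).symm
  rw [this]
  exact Submodule.smul_mem _ _ (Submodule.subset_span ⟨i, rfl⟩)

/-- Over a field of characteristic zero the base change of the Alexander module is a finite product
of modules `K[t] ⧸ (f i)`, and the product of the `f i` is the Alexander polynomial up to a unit. -/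
theorem exists_linearEquiv_pi_of_isBaseChange
    {A : Type} [AddCommGroup A] [Module ℤ[T;T⁻¹] A] {n : ℕ} {x : Fin n → A}
    (hx : Submodule.span ℤ[T;T⁻¹] (Set.range x) = ⊤) {Δ : ℤ[X]} (h0 : Δ.coeff 0 ≠ 0)
    (hΔ : IsGCDOfIdeal (initialFittingIdeal (R := ℤ[T;T⁻¹]) x) (toLaurent Δ))
    {K : Type} [Field K] [CharZero K] [Module.Flat ℤ K] {N : Type} [AddCommGroup N] [Module K N]
    [Module K[X] N] [IsScalarTower K K[X] N]
    (hX : Function.Injective fun v : N => (X : K[X]) • v)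
    {j : A →ₗ[ℤ] N} (hK : IsBaseChange K j)
    (hj : ∀ a, j ((LaurentPolynomial.T 1 : ℤ[T;T⁻¹]) • a) = (X : K[X]) • j a) :
    ∃ (r : ℕ) (f : Fin r → K[X]), (∀ i, (f i).Monic) ∧
      Associated (∏ i, f i) (Δ.map (Int.castRingHom K)) ∧
      Nonempty (N ≃ₗ[K[X]] ∀ i, K[X] ⧸ Ideal.span {f i}) := by
  have hΔ0 : Δ ≠ 0 := by rintro rfl; simp at h0
  set D : K[X] := Δ.map (Int.castRingHom K)
  have hD0 : D.coeff 0 ≠ 0 := by simpa [D] using h0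
  have hDne : D ≠ 0 := by intro h; simp [h] at hD0
  -- the Alexander polynomial kills the base change
  obtain ⟨m, hm, hmI⟩ := hΔ.exists_int_mul_mem hΔ0
  have hkill (v : N) : D • v = 0 := by
    refine hK.inductionOn v (fun v => D • v = 0) (smul_zero _) (fun a => ?_)
      (fun c v hv => ?_) (fun v w hv hw => ?_)
    · have h1 := map_toLaurent_smul (j := j.toAddMonoidHom) hj (Polynomial.C m * Δ) a
      rw [smul_eq_zero_of_mem_initialFittingIdeal hx hmI, map_zero, Polynomial.map_mul, map_C,
        mul_smul, eq_comm] at h1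
      have h2 : (m : K) • D • j a = 0 := by
        rw [← algebraMap_smul K[X] (m : K)]
        exact h1
      exact (smul_eq_zero.1 h2).resolve_left (by exact_mod_cast hm)
    · rw [smul_comm, hv, smul_zero]
    · rw [smul_add, hv, hw, add_zero]
  have hspan : Submodule.span K (Set.range j.toAddMonoidHom) = ⊤ := by
    rw [eq_top_iff]
    intro v _
    exact hK.inductionOn v _ (Submodule.zero_mem _) (fun a => Submodule.subset_span ⟨a, rfl⟩)
      (fun c v hv => Submodule.smul_mem _ _ hv) (fun v w hv hw => Submodule.add_mem _ hv hw)
  have hy : Submodule.span K[X] (Set.range fun i => j (x i)) = ⊤ :=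
    span_range_map_eq_top hj hspan hD0 hkill hx
  have : Module.Finite K[X] N :=
    ⟨hy ▸ Submodule.fg_span (Set.finite_range _)⟩
  obtain ⟨r, f, hf, ⟨E⟩⟩ := exists_linearEquiv_pi_adjoinRoot (N := N)
    fun v => ⟨⟨D, mem_nonZeroDivisors_of_ne_zero hDne⟩, hkill v⟩
  have hfit : (initialFittingIdeal (R := K[X]) fun i => j (x i)) = Ideal.span {∏ i, f i} := by
    rw [← initialFittingIdeal_pi_quotient f, ← initialFittingIdeal_linearEquiv E]
    refine initialFittingIdeal_eq ?_ ?_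
    · rw [Set.range_comp, ← LinearEquiv.coe_coe, ← Submodule.map_span, hy, Submodule.map_top,
        LinearEquiv.range]
    · exact span_range_single_quotient f
  have hdvd1 : D ∣ ∏ i, f i := by
    rw [← Ideal.mem_span_singleton]
    exact initialFittingIdeal_map_le hj hK h0 hΔ.1 (hfit ▸ Ideal.mem_span_singleton_self _)
  -- multiplication by `t` is injective
  have hcoeff : (∏ i, f i).coeff 0 ≠ 0 := by
    rw [Ne, ← X_dvd_iff, prime_X.dvd_finsetProd_iff]
    rintro ⟨i, -, h, hh⟩
    have hne : h ≠ 0 := by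
      rintro rfl
      exact (hf i).ne_zero (by rw [hh, mul_zero])
    have hw0 : Pi.single i (Ideal.Quotient.mk _ h) = (0 : ∀ i, K[X] ⧸ Ideal.span {f i}) := by
      refine (map_eq_zero_iff _ E.symm.injective).1 (hX ?_)
      change (X : K[X]) • _ = (X : K[X]) • 0
      rw [smul_zero, ← map_smul, ← Pi.single_smul]
      have : (X : K[X]) • Ideal.Quotient.mk (Ideal.span {f i}) h = 0 :=
        Ideal.Quotient.eq_zero_iff_mem.2 (hh ▸ Ideal.mem_span_singleton_self _)
      rw [this, Pi.single_zero, map_zero]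
    rw [Pi.single_eq_zero_iff, Ideal.Quotient.eq_zero_iff_mem, Ideal.mem_span_singleton] at hw0
    have h1 := Polynomial.natDegree_le_of_dvd hw0 hne
    rw [hh, natDegree_mul X_ne_zero hne, natDegree_X] at h1
    omega
  have hdvd2 : ∏ i, f i ∣ D := by
    obtain ⟨k, q, hq, hqm⟩ := exists_map_mem_initialFittingIdeal
      (j := j.toAddMonoidHom) hj x hmI
    have hq' : q = X ^ k * (Polynomial.C m * Δ) := by
      refine toLaurent_injective ?_
      rw [hq, map_mul toLaurent (X ^ k), toLaurent_X_pow, mul_comm]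
    change _ ∈ (initialFittingIdeal (R := K[X]) fun i => j (x i)) at hqm
    rw [hfit, Ideal.mem_span_singleton, hq', Polynomial.map_mul, Polynomial.map_pow, map_X,
      Polynomial.map_mul, map_C] at hqm
    refine (IsUnit.dvd_mul_left ?_).1 (dvd_of_dvd_X_pow_mul hcoeff hqm)
    exact Polynomial.isUnit_C.2 (IsUnit.mk0 _ (by simpa using hm))
  exact ⟨r, f, hf, associated_of_dvd_dvd hdvd2 hdvd1, ⟨E⟩⟩

/-- The base change of the Alexander module to a field of characteristic zero as a vector space with
an automorphism: a finite product of companion spaces `K[t] ⧸ (f i)` on which `t` acts by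
multiplication. -/
theorem exists_equiv_pi_adjoinRoot_of_isBaseChange
    {A : Type} [AddCommGroup A] [instA : Module ℤ A] [Module ℤ[T;T⁻¹] A] {n : ℕ} {x : Fin n → A}
    (hx : Submodule.span ℤ[T;T⁻¹] (Set.range x) = ⊤) {Δ : ℤ[X]} (h0 : Δ.coeff 0 ≠ 0)
    (hΔ : IsGCDOfIdeal (initialFittingIdeal (R := ℤ[T;T⁻¹]) x) (toLaurent Δ))
    {K : Type} [Field K] [CharZero K] [Module.Flat ℤ K] {V : Type} [AddCommGroup V] [Module K V]
    (j : A →ₗ[ℤ] V) (hK : IsBaseChange K j) (τ : V ≃ₗ[K] V)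
    (hj : ∀ a, j ((LaurentPolynomial.T 1 : ℤ[T;T⁻¹]) • a) = τ (j a)) :
    ∃ (r : ℕ) (f : Fin r → K[X]) (e : V ≃ₗ[K] ∀ i, AdjoinRoot (f i)), (∀ i, (f i).Monic) ∧
      Associated (∏ i, f i) (Δ.map (Int.castRingHom K)) ∧
      ∀ v i, e (τ v) i = AdjoinRoot.root (f i) * e v i := by
  obtain rfl : instA = AddCommGroup.toIntModule A := Subsingleton.elim _ _
  let N := Module.AEval' (τ : V →ₗ[K] V)
  let o : V ≃ₗ[K] N := Module.AEval'.of (τ : V →ₗ[K] V)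
  have ho (v : V) : o (τ v) = (X : K[X]) • o v :=
    (Module.AEval'.X_smul_of (τ : V →ₗ[K] V) v).symm
  let j' : A →ₗ[ℤ] N := (o.toLinearMap.restrictScalars ℤ).comp j
  have hK' : IsBaseChange K j' := hK.comp (IsBaseChange.ofEquiv o)
  have hj' (a : A) : j' ((LaurentPolynomial.T 1 : ℤ[T;T⁻¹]) • a) = (X : K[X]) • j' a :=
    (congrArg o (hj a)).trans (ho _)
  have hX : Function.Injective fun v : N => (X : K[X]) • v := by
    intro v w hvw
    obtain ⟨v, rfl⟩ := o.surjective v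
    obtain ⟨w, rfl⟩ := o.surjective w
    change (X : K[X]) • o v = (X : K[X]) • o w at hvw
    rw [← ho, ← ho] at hvw
    rw [τ.injective (o.injective hvw)]
  obtain ⟨r, f, hf, hfD, ⟨E⟩⟩ := exists_linearEquiv_pi_of_isBaseChange hx h0 hΔ hX hK' hj'
  refine ⟨r, f, o ≪≫ₗ E.restrictScalars K, hf, hfD, fun v i => ?_⟩
  have : E (o (τ v)) = (X : K[X]) • E (o v) := by rw [ho, map_smul]
  exact congrFun this i

end Structure

/-! ### The value of the Alexander polynomial at one -/

section EvalOne

/-- If `t - 1` is surjective on a module, then the value at `t = 1` of a common divisor of its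
initial Fitting ideal is `± 1`: writing generators as `x = (t - 1) c x` one obtains the element
`det (1 - (t - 1) c)` of the ideal, whose value is `1`. -/
theorem isUnit_eval_one {A : Type} [AddCommGroup A] [Module ℤ[T;T⁻¹] A] {n : ℕ} {x : Fin n → A}
    (hx : Submodule.span ℤ[T;T⁻¹] (Set.range x) = ⊤) {Δ : ℤ[X]}
    (hΔ : ∀ a ∈ initialFittingIdeal (R := ℤ[T;T⁻¹]) x, toLaurent Δ ∣ a)
    (hs : ∀ a : A, ∃ b : A, (T 1 : ℤ[T;T⁻¹]) • b - b = a) : IsUnit (Δ.eval 1) := by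
  have h1 (i : Fin n) : ∃ c : Fin n → ℤ[T;T⁻¹], ∑ j, ((T 1 - 1) * c j) • x j = x i := by
    obtain ⟨b, hb⟩ := hs (x i)
    obtain ⟨c, rfl⟩ := (Submodule.mem_span_range_iff_exists_fun ℤ[T;T⁻¹]).1
      (hx ▸ Submodule.mem_top : b ∈ Submodule.span ℤ[T;T⁻¹] (Set.range x))
    refine ⟨c, ?_⟩
    simp_rw [mul_smul, ← Finset.smul_sum]
    rw [sub_smul, one_smul, hb]
  choose c hc using h1
  let M : Matrix (Fin n) (Fin n) ℤ[T;T⁻¹] := 1 - (T 1 - 1 : ℤ[T;T⁻¹]) • Matrix.of c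
  have hM : M.det ∈ initialFittingIdeal (R := ℤ[T;T⁻¹]) x := by
    refine det_mem_initialFittingIdeal fun i => ?_
    have (j : Fin n) : M i j • x j = (if i = j then x j else 0) - ((T 1 - 1) * c i j) • x j := by
      simp only [M, Matrix.sub_apply, Matrix.smul_apply, Matrix.of_apply, smul_eq_mul,
        sub_smul _ _ (x j), Matrix.one_apply, ite_smul, one_smul, zero_smul]
    rw [Finset.sum_congr rfl fun j _ => this j, Finset.sum_sub_distrib, hc]
    simp
  let ε : ℤ[T;T⁻¹] →+* ℤ := LaurentPolynomial.eval₂ (RingHom.id ℤ) 1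
  have hεT : ε (T 1) = 1 := by simp [ε]
  have hε (q : ℤ[X]) : ε (toLaurent q) = q.eval 1 := by
    simp [ε, LaurentPolynomial.eval₂_toLaurent]
  have hdet : ε M.det = 1 := by
    have : ε.mapMatrix M = 1 := by
      ext i j
      simp [M, hεT, Matrix.one_apply, apply_ite ε]
    rw [RingHom.map_det, this, Matrix.det_one]
  have := map_dvd ε (hΔ _ hM)
  rw [hdet, hε] at this
  exact isUnit_of_dvd_one this

theorem isPrimitive_map_of_isUnit_eval_one {Δ : ℤ[X]} (h : IsUnit (Δ.eval 1)) {R : Type*}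
    [CommRing R] (φ : ℤ →+* R) : (Δ.map φ).IsPrimitive := by
  intro r hr
  have h1 := map_dvd (Polynomial.evalRingHom (1 : R)) hr
  refine isUnit_of_dvd_unit (y := (Δ.map φ).eval 1) (by simpa using h1) ?_
  have : (Δ.map φ).eval 1 = φ (Δ.eval 1) := by
    rw [← map_one φ, eval_map_apply]
  rw [this]
  exact h.map φ

end EvalOne

/-! ### The zeros of the Alexander polynomial -/

section Zeros

variable {L : Type*} [NormedField L]

local notation "gaussNormOne" => gaussNorm (NormedField.toAbsoluteValue L) 1

theorem gaussNorm_X_sub_C (a : L) : gaussNormOne (X - Polynomial.C a) = max 1 ‖a‖ := by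
  refine le_antisymm ?_ (max_le ?_ ?_)
  · obtain ⟨i, hi⟩ := exists_eq_gaussNorm (NormedField.toAbsoluteValue L) 1 (X - Polynomial.C a)
    rw [hi]
    rcases i with _ | _ | i
    · simp [NormedField.toAbsoluteValue]
    · simp [NormedField.toAbsoluteValue]
    · simp [NormedField.toAbsoluteValue, coeff_X]
  · have := le_gaussNorm (NormedField.toAbsoluteValue L) (X - Polynomial.C a) zero_le_one 1
    simpa [NormedField.toAbsoluteValue, coeff_C] using this
  · have := le_gaussNorm (NormedField.toAbsoluteValue L) (X - Polynomial.C a) zero_le_one 0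
    simpa [NormedField.toAbsoluteValue] using this

theorem log_gaussNorm_prod (hna : IsNonarchimedean (norm : L → ℝ)) (s : Multiset L) :
    0 < gaussNormOne (s.map fun a => X - Polynomial.C a).prod ∧
      Real.log (gaussNormOne (s.map fun a => X - Polynomial.C a).prod) =
        (s.map fun a => Real.log (max 1 ‖a‖)).sum := by
  induction s using Multiset.induction_on with
  | empty =>
    have : gaussNormOne (1 : L[X]) = 1 := by
      rw [← Polynomial.C_1, gaussNorm_C, map_one]
    simp [this]
  | cons a s ih =>
    have h1 : 0 < max 1 ‖a‖ := lt_max_of_lt_left one_pos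
    rw [Multiset.map_cons, Multiset.prod_cons, gaussNorm_mul hna one_pos, gaussNorm_X_sub_C,
      Multiset.map_cons, Multiset.sum_cons, Real.log_mul h1.ne' ih.1.ne', ih.2]
    exact ⟨mul_pos h1 ih.1, rfl⟩

open Classical in
theorem sum_filter_log_norm {M : Type*} (φ : M → L) (s : Multiset M) :
    ((s.filter fun a => 1 < ‖φ a‖).map fun a => Real.log ‖φ a‖).sum =
      (s.map fun a => Real.log (max 1 ‖φ a‖)).sum := by
  induction s using Multiset.induction_on with
  | empty => simp
  | cons a s ih =>
    by_cases h : 1 < ‖φ a‖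
    · rw [Multiset.filter_cons_of_pos (p := fun a => 1 < ‖φ a‖) _ h, Multiset.map_cons,
        Multiset.sum_cons, ih, Multiset.map_cons, Multiset.sum_cons, max_eq_right h.le]
    · rw [Multiset.filter_cons_of_neg (p := fun a => 1 < ‖φ a‖) _ h, ih, Multiset.map_cons,
        Multiset.sum_cons, max_eq_left (not_lt.1 h), Real.log_one, zero_add]

variable {p : ℕ} [Fact p.Prime]

theorem PadicAlgCl.norm_intCast (a : ℤ) : ‖(a : PadicAlgCl p)‖ = ‖(a : ℚ_[p])‖ := by
  rw [← PadicAlgCl.norm_extends p (a : ℚ_[p]), map_intCast]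

theorem gaussNorm_map_eq_one_of_isUnit_eval_one {Δ : ℤ[X]} (h : IsUnit (Δ.eval 1)) :
    gaussNorm (NormedField.toAbsoluteValue (PadicAlgCl p)) 1
      (Δ.map (Int.castRingHom (PadicAlgCl p))) = 1 := by
  refine le_antisymm ?_ ?_
  · obtain ⟨i, hi⟩ := exists_eq_gaussNorm (NormedField.toAbsoluteValue (PadicAlgCl p)) 1
      (Δ.map (Int.castRingHom (PadicAlgCl p)))
    rw [hi, one_pow, mul_one, coeff_map]
    refine (PadicAlgCl.norm_intCast _).trans_le (Padic.norm_int_le_one _)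
  · obtain ⟨i, hi⟩ : ∃ i, ¬ (p : ℤ) ∣ Δ.coeff i := by
      by_contra! hc
      have h1 := isPrimitive_map_of_isUnit_eval_one h (RingHom.id ℤ) p
        (by rw [Polynomial.map_id]; exact (C_dvd_iff_dvd_coeff _ _).2 hc)
      exact (Nat.prime_iff_prime_int.1 Fact.out).not_isUnit h1
    have h1 : ‖(Δ.coeff i : ℚ_[p])‖ = 1 :=
      le_antisymm (Padic.norm_int_le_one _)
        (not_lt.1 fun h => hi (Padic.norm_intCast_lt_one_iff.1 h))
    have := le_gaussNorm (NormedField.toAbsoluteValue (PadicAlgCl p))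
      (Δ.map (Int.castRingHom (PadicAlgCl p))) zero_le_one i
    rw [one_pow, mul_one, coeff_map] at this
    refine le_trans (le_of_eq ?_) this
    exact h1.symm.trans (PadicAlgCl.norm_intCast _).symm

/-- The local sum of the zeros is the local term of the leading coefficient: both the Gauss norm of
`Δ` and that of its factorization into linear factors are computed, the former being `1`. -/
theorem localZeroSum_eq {Δ : ℤ[X]} (h : IsUnit (Δ.eval 1))
    (ι : AlgebraicClosure ℚ →+* PadicAlgCl p) :
    localZeroSum Δ p ι = -Real.log ‖(Δ.leadingCoeff : ℚ_[p])‖ := by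
  classical
  have hΔ : Δ ≠ 0 := by rintro rfl; simp at h
  have hna := PadicAlgCl.isNonarchimedean p
  have hsp : Δ.map (algebraMap ℤ (AlgebraicClosure ℚ)) =
      Polynomial.C (Δ.leadingCoeff : AlgebraicClosure ℚ) *
        ((Δ.aroots (AlgebraicClosure ℚ)).map fun a => X - Polynomial.C a).prod := by
    have := (IsAlgClosed.splits (Δ.map (algebraMap ℤ (AlgebraicClosure ℚ)))).eq_prod_roots
    rwa [leadingCoeff_map_of_injective (FaithfulSMul.algebraMap_injective ℤ _)] at this
  have hsp2 : Δ.map (Int.castRingHom (PadicAlgCl p)) =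
      Polynomial.C (Δ.leadingCoeff : PadicAlgCl p) *
        (((Δ.aroots (AlgebraicClosure ℚ)).map ι).map fun a => X - Polynomial.C a).prod := by
    have := congrArg (Polynomial.map ι) hsp
    rw [Polynomial.map_map, Polynomial.map_mul, Polynomial.map_multiset_prod, map_C, map_intCast,
      Multiset.map_map] at this
    rw [Multiset.map_map, Subsingleton.elim (Int.castRingHom (PadicAlgCl p)) (ι.comp _), this]
    congr 3
    ext1 a
    simp
  have hg := gaussNorm_map_eq_one_of_isUnit_eval_one (p := p) h
  rw [hsp2, gaussNorm_mul hna one_pos, gaussNorm_C] at hg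
  obtain ⟨hpos, hlog⟩ := log_gaussNorm_prod hna ((Δ.aroots (AlgebraicClosure ℚ)).map ι)
  have hg' := congrArg Real.log hg
  have hne : NormedField.toAbsoluteValue (PadicAlgCl p) (Δ.leadingCoeff : PadicAlgCl p) ≠ 0 := by
    simpa using hΔ
  rw [Real.log_mul hne hpos.ne', hlog, Real.log_one, Multiset.map_map] at hg'
  have h3 : NormedField.toAbsoluteValue (PadicAlgCl p) (Δ.leadingCoeff : PadicAlgCl p) =
      ‖(Δ.leadingCoeff : ℚ_[p])‖ :=
    PadicAlgCl.norm_intCast _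
  rw [h3] at hg'
  rw [eq_neg_iff_add_eq_zero, add_comm, ← hg', localZeroSum]
  congr 1
  exact sum_filter_log_norm ι _

end Zeros

section SumOverPrimes

theorem neg_log_norm_intCast (p : ℕ) [Fact p.Prime] {a : ℤ} (ha : a ≠ 0) :
    -Real.log ‖(a : ℚ_[p])‖ = a.natAbs.factorization p * Real.log p := by
  have hp : p.Prime := Fact.out
  rw [Padic.norm_eq_zpow_neg_valuation (by exact_mod_cast ha), Real.log_zpow,
    Padic.valuation_intCast, Nat.factorization_def _ hp]
  simp [padicValInt]

/-- The product formula. -/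
theorem hasSum_neg_log_norm {a : ℤ} (ha : a ≠ 0) :
    HasSum (fun p : Nat.Primes => -Real.log ‖(a : ℚ_[(p : ℕ)])‖) (Real.log |(a : ℝ)|) := by
  have h1 : (fun p : Nat.Primes => -Real.log ‖(a : ℚ_[(p : ℕ)])‖) =
      (fun p : ℕ => a.natAbs.factorization p * Real.log p) ∘ (fun p : Nat.Primes => (p : ℕ)) := by
    ext p
    exact neg_log_norm_intCast p ha
  have h2 : Real.log |(a : ℝ)| =
      ∑ p ∈ a.natAbs.primeFactors, a.natAbs.factorization p * Real.log p := by
    have hn : (a.natAbs : ℝ) = |(a : ℝ)| := by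
      rw [Nat.cast_natAbs, Int.cast_abs]
    rw [← hn]
    conv_lhs => rw [← Nat.prod_factorization_pow_eq_self (Int.natAbs_ne_zero.2 ha)]
    rw [Finsupp.prod, Nat.cast_prod, Real.log_prod]
    · simp
    · intro p hp
      have := (Nat.prime_of_mem_primeFactors hp).ne_zero
      positivity
  rw [h1, h2]
  have hinj : Function.Injective (fun p : Nat.Primes => (p : ℕ)) := Subtype.val_injective
  rw [hinj.hasSum_iff]
  · refine hasSum_sum_of_ne_finset_zero fun p hp => ?_
    rw [← Nat.support_factorization, Finsupp.notMem_support_iff] at hp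
    rw [hp, Nat.cast_zero, zero_mul]
  · intro p hp
    have : ¬ p.Prime := fun h => hp ⟨⟨p, h⟩, rfl⟩
    rw [Nat.factorization_eq_zero_of_not_prime _ this, Nat.cast_zero, zero_mul]

end SumOverPrimes

/-! ### Integral linear recurrent sequences over the `p`-adic numbers -/

namespace AdjoinRoot

variable {K : Type*} [Field K] {f : K[X]}

/-- The linear functional on `K[t] ⧸ (f)` which takes the coefficient of `t ^ (deg f - 1)` in the
representative of degree less than `deg f`. For `v` in `K[t] ⧸ (f)` the sequence
`k ↦ topCoeff (t ^ k * v)` is a linear recurrent sequence with characteristic polynomial `f`, and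
all such sequences arise in this way. -/
def topCoeff (hf : f.Monic) : AdjoinRoot f →ₗ[K] K :=
  lcoeff K (f.natDegree - 1) ∘ₗ modByMonicHom hf

theorem eq_zero_of_topCoeff_eq_zero (hf : f.Monic) {v : AdjoinRoot f}
    (h : ∀ k < f.natDegree, topCoeff hf (root f ^ k * v) = 0) : v = 0 := by
  by_contra hv
  set P := modByMonicHom hf v with hP
  have hPv : mk f P = v := mk_leftInverse hf v
  have hP0 : P ≠ 0 := by
    rintro h0
    exact hv (by rw [← hPv, h0, map_zero])
  have hdeg : P.natDegree < f.natDegree := by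
    have h1 : P = P %ₘ f := by
      rw [hP, ← modByMonicHom_mk hf, ← hP, hPv]
    refine natDegree_lt_natDegree hP0 ?_
    rw [h1]
    exact degree_modByMonic_lt _ hf
  refine hP0 (leadingCoeff_eq_zero.1 ?_)
  rw [← h (f.natDegree - 1 - P.natDegree) (by omega), ← hPv, ← mk_X, ← map_pow, ← map_mul, topCoeff,
    LinearMap.comp_apply, modByMonicHom_mk hf, (modByMonic_eq_self_iff hf).2, lcoeff_apply]
  · rw [coeff_X_pow_mul', if_pos (Nat.sub_le _ _), Nat.sub_sub_self (Nat.le_sub_one_of_lt hdeg),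
      leadingCoeff]
  · refine degree_lt_degree ?_
    rw [natDegree_mul (pow_ne_zero _ X_ne_zero) hP0, natDegree_X_pow]
    omega

/-- Every linear functional on `K[t] ⧸ (f)` has the form `u ↦ topCoeff (u * v)`. -/
theorem exists_topCoeff_mul_eq (hf : f.Monic) (φ : AdjoinRoot f →ₗ[K] K) :
    ∃ v, ∀ u, φ u = topCoeff hf (u * v) := by
  have : Module.Finite K (AdjoinRoot f) := (powerBasis' hf).finite
  let Ψ : AdjoinRoot f →ₗ[K] Module.Dual K (AdjoinRoot f) :=
    (LinearMap.mul K (AdjoinRoot f)).flip.compr₂ (topCoeff hf)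
  have hinj : Function.Injective Ψ := by
    rw [← LinearMap.ker_eq_bot, LinearMap.ker_eq_bot']
    intro v hv
    exact eq_zero_of_topCoeff_eq_zero hf fun k _ => LinearMap.congr_fun hv (root f ^ k)
  obtain ⟨v, hv⟩ := (LinearMap.injective_iff_surjective_of_finrank_eq_finrank
    Subspace.dual_finrank_eq.symm).1 hinj φ
  exact ⟨v, fun u => by rw [← hv]; rfl⟩

end AdjoinRoot

section Padic

variable {p : ℕ} [Fact p.Prime]

/-- A primitive vector of a lattice takes a unit value under some integral functional. -/
theorem exists_integral_functional {W : Type*} [AddCommGroup W] [Module ℚ_[p] W] [Module ℤ_[p] W]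
    [IsScalarTower ℤ_[p] ℚ_[p] W] (L : Submodule ℤ_[p] W) [Submodule.IsLattice ℚ_[p] L]
    {y : W} (hy : y ∈ L) (hp : ∀ z ∈ L, y ≠ (p : ℤ_[p]) • z) :
    ∃ φ : W →ₗ[ℚ_[p]] ℚ_[p], (∀ z ∈ L, ‖φ z‖ ≤ 1) ∧ ‖φ y‖ = 1 := by
  classical
  have : Module.Free ℤ_[p] L := Submodule.IsLattice.free ℚ_[p] L
  have : Module.Finite ℤ_[p] L := Module.Finite.iff_fg.2 Submodule.IsLattice.fg
  let β := Module.Free.chooseBasis ℤ_[p] L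
  let B := β.extendOfIsLattice ℚ_[p]
  have hB (z : L) (j) : B.coord j z = (β.repr z j : ℤ_[p]) := by
    conv_lhs => rw [← β.sum_repr z]
    have h1 (i : _) : ((β.repr z i • β i : L) : W) = ((β.repr z i : ℤ_[p]) : ℚ_[p]) • B i := by
      rw [Module.Basis.extendOfIsLattice_apply]
      exact (algebraMap_smul ℚ_[p] (β.repr z i) ((β i : L) : W)).symm
    rw [Submodule.coe_sum, Finset.sum_congr rfl fun i _ => h1 i, map_sum]
    simp [Finsupp.single_apply]
  obtain ⟨j, hj⟩ : ∃ j, ‖β.repr ⟨y, hy⟩ j‖ = 1 := by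
    by_contra! hc
    have h1 (j) : ∃ c : ℤ_[p], β.repr ⟨y, hy⟩ j = p * c := by
      have := lt_of_le_of_ne (PadicInt.norm_le_one _) (hc j)
      exact (PadicInt.norm_lt_one_iff_dvd _).1 this
    choose c hc using h1
    refine hp (∑ j, c j • β j : L) (SetLike.coe_mem _) ?_
    rw [← Submodule.coe_smul, Finset.smul_sum]
    have := β.sum_repr ⟨y, hy⟩
    simp_rw [hc, mul_smul] at this
    rw [this]
  refine ⟨B.coord j, fun z hz => ?_, ?_⟩
  · rw [hB ⟨z, hz⟩]
    exact PadicInt.norm_le_one _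
  · rw [hB ⟨y, hy⟩]
    exact hj

variable {f : ℚ_[p][X]} {g : ℤ_[p][X]} {u : ℚ_[p]}

local notation "ρ" => algebraMap ℤ_[p] ℚ_[p]

open AdjoinRoot

/-- A primitive polynomial `g` with root `t` yields a recursion for the sequence
`topCoeff (t ^ k * v)`; so when its terms before the `N`-th are integral, the `N`-th term becomes
integral upon multiplication by the leading coefficient of `g`. -/
theorem norm_leadingCoeff_mul_topCoeff_le (hf : f.Monic)
    (hgf : g.map ρ = Polynomial.C u * f) {N : ℕ} (hN : g.natDegree ≤ N)
    {v : AdjoinRoot f} (hv : ∀ k < N, ‖topCoeff hf (root f ^ k * v)‖ ≤ 1) :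
    ‖ρ g.leadingCoeff * topCoeff hf (root f ^ N * v)‖ ≤ 1 := by
  have h0 : mk f ((g.map ρ) * X ^ (N - g.natDegree)) = 0 := by
    rw [mk_eq_zero, hgf]
    exact ⟨Polynomial.C u * X ^ (N - g.natDegree), by ring⟩
  have h1 : ∑ k ∈ Finset.range (g.natDegree + 1),
      ρ (g.coeff k) * topCoeff hf (root f ^ (k + (N - g.natDegree)) * v) = 0 := by
    have hg : g.map ρ * X ^ (N - g.natDegree) = ∑ k ∈ Finset.range (g.natDegree + 1),
        Polynomial.C (ρ (g.coeff k)) * X ^ (k + (N - g.natDegree)) := by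
      conv_lhs => enter [1]; rw [as_sum_range_C_mul_X_pow g]
      rw [Polynomial.map_sum, Finset.sum_mul]
      refine Finset.sum_congr rfl fun k _ => ?_
      rw [Polynomial.map_mul, map_C, Polynomial.map_pow, map_X, mul_assoc, ← pow_add]
    rw [hg, map_sum] at h0
    have h2 := congrArg (fun w => topCoeff hf (w * v)) h0
    simp only [Finset.sum_mul, map_sum, zero_mul, map_zero] at h2
    rw [← h2]
    refine Finset.sum_congr rfl fun k _ => ?_
    rw [map_mul (mk f), map_pow (mk f), mk_X, mk_C, ← AdjoinRoot.algebraMap_eq, mul_assoc,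
      ← Algebra.smul_def (ρ (g.coeff k)) (root f ^ _ * v), (topCoeff hf).map_smul, smul_eq_mul]
  rw [Finset.sum_range_succ, Nat.add_sub_cancel' hN, add_comm, add_eq_zero_iff_eq_neg] at h1
  rw [leadingCoeff, h1, norm_neg]
  refine IsUltrametricDist.norm_sum_le_of_forall_le_of_nonneg zero_le_one fun k hk => ?_
  rw [Finset.mem_range] at hk
  rw [norm_mul]
  exact mul_le_one₀ (PadicInt.norm_le_one _) (norm_nonneg _) (hv _ (by omega))

/-- The bound on the `N`-th term is attained when the leading coefficient of `g` is not a unit: the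
leading coefficient of `g` times `t ^ N` is then a primitive vector of the lattice spanned by
`1, t, …, t ^ (N - 1)`, by Gauss's lemma. -/
theorem exists_norm_leadingCoeff_mul_topCoeff_eq (hf : f.Monic) (hg : g.IsPrimitive) (hu : u ≠ 0)
    (hgf : g.map ρ = Polynomial.C u * f) {N : ℕ} (hN : g.natDegree ≤ N)
    (hlead : ‖g.leadingCoeff‖ < 1) :
    ∃ v : AdjoinRoot f, (∀ k < N, ‖topCoeff hf (root f ^ k * v)‖ ≤ 1) ∧
      ‖ρ g.leadingCoeff * topCoeff hf (root f ^ N * v)‖ = 1 := by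
  have hdeg : g.natDegree = f.natDegree := by
    rw [← natDegree_map_eq_of_injective (FaithfulSMul.algebraMap_injective ℤ_[p] ℚ_[p]) g, hgf,
      natDegree_C_mul hu]
  let L : Submodule ℤ_[p] (AdjoinRoot f) :=
    Submodule.span ℤ_[p] (Set.range fun k : Fin N => root f ^ (k : ℕ))
  have hpow (k : ℕ) (hk : k < N) : root f ^ k ∈ L := Submodule.subset_span ⟨⟨k, hk⟩, rfl⟩
  have : Submodule.IsLattice ℚ_[p] L := by
    refine ⟨Submodule.fg_span (Set.finite_range _), ?_⟩
    rw [eq_top_iff, ← (powerBasis' hf).basis.span_eq, Submodule.span_le]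
    rintro _ ⟨i, rfl⟩
    rw [PowerBasis.basis_eq_pow, powerBasis'_gen]
    refine Submodule.subset_span (hpow _ (i.2.trans_le ?_))
    rw [powerBasis'_dim]
    omega
  have hmem (z : AdjoinRoot f) (hz : z ∈ L) :
      ∃ h : ℤ_[p][X], h.degree < N ∧ z = mk f (h.map ρ) := by
    obtain ⟨c, rfl⟩ := (Submodule.mem_span_range_iff_exists_fun _).1 hz
    refine ⟨∑ k : Fin N, Polynomial.C (c k) * X ^ (k : ℕ), degree_sum_fin_lt c, ?_⟩
    rw [Polynomial.map_sum, map_sum]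
    refine Finset.sum_congr rfl fun k _ => ?_
    rw [Polynomial.map_mul, map_C, Polynomial.map_pow, map_X, map_mul, map_pow, mk_X, mk_C,
      ← AdjoinRoot.algebraMap_eq, ← Algebra.smul_def, algebraMap_smul]
  have hmem' (h : ℤ_[p][X]) (hh : h.degree < N) : mk f (h.map ρ) ∈ L := by
    rw [h.as_sum_support_C_mul_X_pow, Polynomial.map_sum, map_sum]
    refine Submodule.sum_mem _ fun k hk => ?_
    rw [Polynomial.map_mul, map_C, Polynomial.map_pow, map_X, map_mul, map_pow, mk_X, mk_C,
      ← AdjoinRoot.algebraMap_eq, ← Algebra.smul_def, algebraMap_smul]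
    refine Submodule.smul_mem _ _ (hpow k ?_)
    exact_mod_cast (le_degree_of_ne_zero (mem_support_iff.1 hk)).trans_lt hh
  have hyL : g.leadingCoeff • root f ^ N ∈ L := by
    have hd : (Polynomial.C g.leadingCoeff * X ^ N - g * X ^ (N - g.natDegree)).degree <
        (N : WithBot ℕ) := by
      rw [degree_lt_iff_coeff_zero]
      intro m hm
      rw [coeff_sub, coeff_C_mul_X_pow, coeff_mul_X_pow', if_pos ((Nat.sub_le _ _).trans hm)]
      rcases eq_or_lt_of_le hm with rfl | hm
      · simp only [if_true, Nat.sub_sub_self hN, leadingCoeff, sub_self]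
      · simp only [if_neg hm.ne']
        rw [coeff_eq_zero_of_natDegree_lt (by omega), sub_self]
    have := hmem' _ hd
    rwa [Polynomial.map_sub, map_sub, Polynomial.map_mul ρ (p := g), hgf, map_mul (mk f) (_ * f),
      map_mul (mk f) _ f, mk_self, mul_zero, zero_mul, sub_zero, Polynomial.map_mul, map_C,
      Polynomial.map_pow, map_X, map_mul, map_pow, mk_X, mk_C, ← AdjoinRoot.algebraMap_eq,
      ← Algebra.smul_def, algebraMap_smul] at this
  have hprim : ∀ z ∈ L, g.leadingCoeff • root f ^ N ≠ (p : ℤ_[p]) • z := by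
    intro z hz he
    obtain ⟨h, hh, rfl⟩ := hmem z hz
    let H : ℤ_[p][X] := Polynomial.C g.leadingCoeff * X ^ N - Polynomial.C (p : ℤ_[p]) * h
    have hdvd : g ∣ H := by
      refine hg.dvd_of_fraction_map_dvd_fraction_map (K := ℚ_[p]) ?_
      rw [hgf, IsUnit.mul_left_dvd (Polynomial.isUnit_C.2 hu.isUnit), ← mk_eq_zero]
      have h1 (c : ℤ_[p]) (z : AdjoinRoot f) : c • z = mk f (Polynomial.C (ρ c)) * z := by
        rw [mk_C, ← AdjoinRoot.algebraMap_eq, ← Algebra.smul_def, algebraMap_smul]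
      rw [h1, h1, ← mk_X, ← map_pow, ← map_mul, ← map_mul, ← sub_eq_zero, ← map_sub] at he
      simpa [H] using he
    obtain ⟨w, hw⟩ := hdvd
    -- reduction modulo `p`
    let κ : ℤ_[p] →+* ZMod p := PadicInt.toZMod
    have hκ (c : ℤ_[p]) : κ c = 0 ↔ (p : ℤ_[p]) ∣ c := by
      rw [← RingHom.mem_ker, PadicInt.ker_toZMod, PadicInt.maximalIdeal_eq_span_p,
        Ideal.mem_span_singleton]
    have hH0 : H.map κ = 0 := by
      rw [Polynomial.map_sub, Polynomial.map_mul, Polynomial.map_mul, map_C, map_C,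
        (hκ _).2 ((PadicInt.norm_lt_one_iff_dvd _).1 hlead), (hκ _).2 dvd_rfl]
      simp
    have hg0 : g.map κ ≠ 0 := by
      intro h0
      refine PadicInt.prime_p.not_isUnit (hg _ ((C_dvd_iff_dvd_coeff _ _).2 fun i => ?_))
      rw [← hκ, ← coeff_map, h0, coeff_zero]
    have hw0 : w.map κ = 0 := by
      rw [hw, Polynomial.map_mul] at hH0
      exact (mul_eq_zero.1 hH0).resolve_left hg0
    have hgl : g.leadingCoeff ≠ 0 := leadingCoeff_ne_zero.2 hg.ne_zero
    have hdeg2 : (Polynomial.C (p : ℤ_[p]) * h).degree <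
        (Polynomial.C g.leadingCoeff * X ^ N).degree := by
      rw [degree_C_mul_X_pow _ hgl]
      refine lt_of_le_of_lt ?_ hh
      rw [← Polynomial.smul_eq_C_mul]
      exact degree_smul_le _ _
    have hHl : H.leadingCoeff = g.leadingCoeff := by
      rw [leadingCoeff_sub_of_degree_lt hdeg2, leadingCoeff_C_mul_X_pow]
    have hwl : w.leadingCoeff = 1 := by
      rw [hw, leadingCoeff_mul] at hHl
      exact mul_left_cancel₀ hgl (hHl.trans (mul_one _).symm)
    have := congrArg (fun q => q.coeff w.natDegree) hw0
    simp only [coeff_map, coeff_natDegree, hwl, map_one, coeff_zero] at this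
    exact one_ne_zero this
  obtain ⟨φ, hφ, hφy⟩ := exists_integral_functional L hyL hprim
  obtain ⟨v, hv⟩ := exists_topCoeff_mul_eq hf φ
  refine ⟨v, fun k hk => ?_, ?_⟩
  · rw [← hv]
    exact hφ _ (hpow k hk)
  · rwa [← algebraMap_smul ℚ_[p] g.leadingCoeff, map_smul, smul_eq_mul, hv] at hφy

end Padic

/-! ### Subgroups of integral sequences and their indices -/

section IntegralTerms

variable {p : ℕ} [Fact p.Prime] {r : ℕ} {f : Fin r → ℚ_[p][X]}

open AdjoinRoot

/-- The elements of `∏ i, K[t] ⧸ (f i)` for which the first `n + deg (f i)` terms of the associated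
linear recurrent sequences are bounded by `‖c‖`. For `n = 0` this is a lattice, and multiplication
by `t` shifts the sequences. -/
def boundedTerms (hf : ∀ i, (f i).Monic) (c : ℚ_[p]) (n : ℕ) :
    AddSubgroup (∀ i, AdjoinRoot (f i)) where
  carrier := {v | ∀ i, ∀ k < n + (f i).natDegree, ‖topCoeff (hf i) (root (f i) ^ k * v i)‖ ≤ ‖c‖}
  zero_mem' := fun i k _ => by simp
  add_mem' := fun {v w} hv hw i k hk => by
    rw [Pi.add_apply, mul_add, map_add]
    exact (Padic.nonarchimedean _ _).trans (max_le (hv i k hk) (hw i k hk))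
  neg_mem' := fun {v} hv i k hk => by
    rw [Pi.neg_apply, mul_neg, map_neg, norm_neg]
    exact hv i k hk

theorem mem_boundedTerms {hf : ∀ i, (f i).Monic} {c : ℚ_[p]} {n : ℕ} {v : ∀ i, AdjoinRoot (f i)} :
    v ∈ boundedTerms hf c n ↔
      ∀ i, ∀ k < n + (f i).natDegree, ‖topCoeff (hf i) (root (f i) ^ k * v i)‖ ≤ ‖c‖ := Iff.rfl

theorem boundedTerms_anti (hf : ∀ i, (f i).Monic) (c : ℚ_[p]) : Antitone (boundedTerms hf c) :=
  fun _ _ hmn _ hv i k hk => hv i k (hk.trans_le (Nat.add_le_add_right hmn _))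

/-- The first `n + deg (f i)` terms are bounded if and only if the first `deg (f i)` terms of the
first `n` shifts are. -/
theorem mem_boundedTerms_iff_forall_shift {hf : ∀ i, (f i).Monic} {c : ℚ_[p]} {n : ℕ}
    {v : ∀ i, AdjoinRoot (f i)} :
    v ∈ boundedTerms hf c n ↔
      ∀ k ≤ n, (fun i => root (f i) ^ k * v i) ∈ boundedTerms hf c 0 := by
  simp only [mem_boundedTerms]
  constructor
  · intro h k hk i l hl
    rw [← mul_assoc, ← pow_add]
    exact h i _ (by omega)
  · intro h i k hk
    rcases Nat.eq_zero_or_pos (f i).natDegree with hd | hd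
    · -- in degree zero the module vanishes
      have : v i = 0 := eq_zero_of_topCoeff_eq_zero (hf i) fun k hk => by omega
      simp [this]
    · have := h (min k n) (min_le_right _ _) i (k - min k n) (by omega)
      rwa [← mul_assoc, ← pow_add, Nat.sub_add_cancel (min_le_left _ _)] at this

variable {g : Fin r → ℤ_[p][X]} {u : Fin r → ℚ_[p]}

local notation "ρ" => algebraMap ℤ_[p] ℚ_[p]

/-- The index of the subgroup of elements with one more bounded term: the new term may be arbitrary
modulo the bound, but only with the leading coefficient of `g i` as denominator. -/
theorem relIndex_boundedTerms (hf : ∀ i, (f i).Monic) (hg : ∀ i, (g i).IsPrimitive)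
    (hu : ∀ i, u i ≠ 0) (hgf : ∀ i, (g i).map ρ = Polynomial.C (u i) * f i) {c : ℚ_[p]} (hc : c ≠ 0)
    (n : ℕ) :
    (boundedTerms hf c (n + 1)).relIndex (boundedTerms hf c n) =
      ∏ i, p ^ (g i).leadingCoeff.valuation := by
  have hdeg (i : Fin r) : (g i).natDegree = (f i).natDegree := by
    rw [← natDegree_map_eq_of_injective (FaithfulSMul.algebraMap_injective ℤ_[p] ℚ_[p]) (g i), hgf,
      natDegree_C_mul (hu i)]
  have hl (i : Fin r) : (g i).leadingCoeff ≠ 0 := leadingCoeff_ne_zero.2 (hg i).ne_zero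
  let N (i : Fin r) := n + (f i).natDegree
  let s (i : Fin r) (v : ∀ i, AdjoinRoot (f i)) : ℚ_[p] :=
    ρ (g i).leadingCoeff * topCoeff (hf i) (root (f i) ^ N i * (c⁻¹ • v i))
  have hs (v : ∀ i, AdjoinRoot (f i)) (hv : v ∈ boundedTerms hf c n) (i : Fin r) : ‖s i v‖ ≤ 1 := by
    refine norm_leadingCoeff_mul_topCoeff_le (hf i) (hgf i)
      ((hdeg i).trans_le (Nat.le_add_left _ _)) fun k hk => ?_
    rw [mul_smul_comm, map_smul, norm_smul, norm_inv, ← div_eq_inv_mul]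
    exact div_le_one_of_le₀ (hv i k hk) (norm_nonneg _)
  have hσ (v : boundedTerms hf c n) (i : Fin r) : ∃ x : ℤ_[p], ρ x = s i v :=
    ⟨⟨s i v, hs v v.2 i⟩, rfl⟩
  choose σ hσ using hσ
  have hinj : Function.Injective ρ := FaithfulSMul.algebraMap_injective ℤ_[p] ℚ_[p]
  have hσ0 : σ 0 = 0 := by
    ext1 i
    refine hinj ?_
    rw [hσ]
    simp [s]
  have hσadd (v w : boundedTerms hf c n) : σ (v + w) = σ v + σ w := by
    ext1 i
    refine hinj ?_
    rw [hσ, Pi.add_apply, map_add, hσ, hσ]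
    simp [s, mul_add]
  let Ψ : boundedTerms hf c n →+ ∀ i, ZMod (p ^ (g i).leadingCoeff.valuation) :=
    { toFun := fun v i => PadicInt.toZModPow _ (σ v i)
      map_zero' := by
        ext1 i
        rw [hσ0, Pi.zero_apply, map_zero, Pi.zero_apply]
      map_add' := fun v w => by
        ext1 i
        rw [hσadd, Pi.add_apply, map_add, Pi.add_apply] }
  have hker : (boundedTerms hf c (n + 1)).addSubgroupOf (boundedTerms hf c n) = Ψ.ker := by
    ext v
    rw [AddSubgroup.mem_addSubgroupOf, AddMonoidHom.mem_ker, funext_iff, mem_boundedTerms]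
    refine forall_congr' fun i => ?_
    have h1 : Ψ v i = 0 ↔ ‖topCoeff (hf i) (root (f i) ^ N i * v.1 i)‖ ≤ ‖c‖ := by
      change PadicInt.toZModPow _ (σ v i) = 0 ↔ _
      rw [← RingHom.mem_ker, PadicInt.ker_toZModPow, ← PadicInt.norm_le_pow_iff_mem_span_pow,
        ← PadicInt.norm_eq_zpow_neg_valuation (hl i)]
      change ‖ρ (σ v i)‖ ≤ _ ↔ _
      rw [hσ, norm_mul, mul_smul_comm, map_smul, norm_smul, norm_inv]
      have hpos : 0 < ‖(g i).leadingCoeff‖ := norm_pos_iff.2 (hl i)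
      change ‖(g i).leadingCoeff‖ * _ ≤ _ ↔ _
      rw [mul_le_iff_le_one_right hpos, inv_mul_le_one₀ (norm_pos_iff.2 hc)]
    rw [Pi.zero_apply, h1]
    constructor
    · intro h
      exact h _ (by simp only [N]; omega)
    · intro h k hk
      rcases Nat.lt_or_ge k (N i) with h2 | h2
      · exact v.2 i k h2
      · rwa [show k = N i by simp only [N] at h2 ⊢; omega]
  have hsurj : Function.Surjective Ψ := by
    intro z
    have h1 (i : Fin r) : ∃ v : AdjoinRoot (f i),
        (∀ k < N i, ‖topCoeff (hf i) (root (f i) ^ k * v)‖ ≤ 1) ∧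
        ∃ y : ℤ_[p], (y : ℚ_[p]) = ρ (g i).leadingCoeff * topCoeff (hf i) (root (f i) ^ N i * v) ∧
          PadicInt.toZModPow _ y = z i := by
      rcases eq_or_ne (g i).leadingCoeff.valuation 0 with h0 | h0
      · refine ⟨0, by simp, 0, by simp, ?_⟩
        have : Subsingleton (ZMod (p ^ (g i).leadingCoeff.valuation)) := by
          rw [h0, pow_zero]
          infer_instance
        exact Subsingleton.elim _ _
      · have hlt : ‖(g i).leadingCoeff‖ < 1 := by
          rw [PadicInt.norm_eq_zpow_neg_valuation (hl i)]
          exact zpow_lt_one_of_neg₀ (by exact_mod_cast (Fact.out : p.Prime).one_lt) (by omega)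
        obtain ⟨v, hv, hv1⟩ := exists_norm_leadingCoeff_mul_topCoeff_eq (hf i) (hg i) (hu i) (hgf i)
          ((hdeg i).trans_le (Nat.le_add_left _ n)) hlt
        let y : ℤ_[p] := ⟨_, hv1.le⟩
        have hy : IsUnit y := PadicInt.isUnit_iff.2 hv1
        obtain ⟨m, hm⟩ := ZMod.ringHom_surjective
          (PadicInt.toZModPow (p := p) (g i).leadingCoeff.valuation) (z i)
        obtain ⟨y', hy'⟩ := hy.exists_left_inv
        refine ⟨ρ (m * y') • v, fun k hk => ?_, m, ?_, hm⟩
        · rw [mul_smul_comm, map_smul, norm_smul]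
          exact mul_le_one₀ (PadicInt.norm_le_one _) (norm_nonneg _) (hv k hk)
        · rw [mul_smul_comm, map_smul, smul_eq_mul, mul_left_comm]
          change (m : ℚ_[p]) = ρ (m * y') * ρ y
          rw [← map_mul, mul_assoc, hy', mul_one]
          rfl
    choose v hv y hy hyz using h1
    have hmem : (fun i => c • v i) ∈ boundedTerms hf c n := fun i k hk => by
      rw [mul_smul_comm, map_smul, norm_smul]
      exact mul_le_of_le_one_right (norm_nonneg _) (hv i k hk)
    refine ⟨⟨_, hmem⟩, ?_⟩
    ext i
    rw [← hyz i]
    change PadicInt.toZModPow _ (σ ⟨_, hmem⟩ i) = _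
    congr 1
    refine hinj ?_
    rw [hσ]
    refine Eq.trans ?_ (hy i).symm
    simp only [s]
    rw [smul_smul, inv_mul_cancel₀ hc, one_smul]
  rw [AddSubgroup.relIndex, hker, AddSubgroup.index_ker, AddMonoidHom.range_eq_top.2 hsurj,
    AddSubgroup.card_top, Nat.card_pi]
  simp

end IntegralTerms

/-! ### Bowen's entropy from chains of subgroups -/

section Entropy

open Filter Topology

theorem measure_eq_relIndex_mul {E : Type*} [AddGroup E] [MeasurableSpace E] [MeasurableAdd E]
    (μ : Measure E) [μ.IsAddLeftInvariant] {G H : AddSubgroup E} (hHG : H ≤ G)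
    (hG : MeasurableSet (G : Set E)) (hH : MeasurableSet (H : Set E)) (h0 : H.relIndex G ≠ 0) :
    μ G = H.relIndex G * μ H := by
  have hemb : MeasurableEmbedding G.subtype := MeasurableEmbedding.subtype_coe hG
  have hadd : MeasurableAdd G := ⟨fun c => (measurable_subtype_coe.const_add (c : E)).subtype_mk,
    fun c => (measurable_subtype_coe.add_const (c : E)).subtype_mk⟩
  have hinv : (μ.comap G.subtype).IsAddLeftInvariant :=
    Measure.IsAddLeftInvariant.comap μ hemb
  have : (H.addSubgroupOf G).FiniteIndex := ⟨h0⟩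
  have h1 := (H.addSubgroupOf G).index_mul_measure (measurable_subtype_coe hH) (μ.comap G.subtype)
  rw [hemb.comap_apply, hemb.comap_apply, Set.image_univ] at h1
  have h2 : Set.range G.subtype = G := Subtype.range_coe
  have h3 : G.subtype '' (H.addSubgroupOf G : Set G) = H := by
    ext x
    constructor
    · rintro ⟨y, hy, rfl⟩
      exact hy
    · intro hx
      exact ⟨⟨x, hHG hx⟩, hx, rfl⟩
  rw [h2, h3] at h1
  exact h1.symm

theorem measure_eq_pow_mul_of_relIndex {E : Type*} [AddGroup E] [MeasurableSpace E]
    [MeasurableAdd E] (μ : Measure E) [μ.IsAddLeftInvariant] {A : ℕ → AddSubgroup E}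
    (hA : Antitone A) (hm : ∀ n, MeasurableSet (A n : Set E)) {q : ℕ} (hq : q ≠ 0)
    (h : ∀ n, (A (n + 1)).relIndex (A n) = q) (n : ℕ) : μ (A 0) = q ^ n * μ (A n) := by
  induction n with
  | zero => simp
  | succ n ih =>
    rw [ih, measure_eq_relIndex_mul μ (hA n.le_succ) (hm _) (hm _) (by rwa [h]), h, pow_succ,
      mul_assoc]

/-- If all Bowen balls lie between members of two chains of open subgroups in which each member has
index `q` in the preceding one, then the entropy is `log q`. -/
theorem bowenEntropy_eq_log {E : Type} [NormedAddCommGroup E] [ProperSpace E] [MeasurableSpace E]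
    [BorelSpace E] (μ : Measure E) [μ.IsAddHaarMeasure] {T : E → E} {q : ℕ} (hq : q ≠ 0)
    (h : ∀ ε > 0, ∃ A B : ℕ → AddSubgroup E, Antitone A ∧ Antitone B ∧
      (∀ n, IsOpen (A n : Set E)) ∧ (∀ n, IsOpen (B n : Set E)) ∧
      (∀ n, (A (n + 1)).relIndex (A n) = q) ∧ (∀ n, (B (n + 1)).relIndex (B n) = q) ∧
      Bornology.IsBounded (B 0 : Set E) ∧
      ∀ n, (A n : Set E) ⊆ ⋂ k ∈ Finset.range (n + 1), T^[k] ⁻¹' Metric.ball 0 ε ∧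
        (⋂ k ∈ Finset.range (n + 1), T^[k] ⁻¹' Metric.ball 0 ε) ⊆ B n) :
    bowenEntropy μ T = ((Real.log q : ℝ) : EReal) := by
  have hε (ε : Set.Ioi (0 : ℝ)) : limsup (fun n : ℕ =>
      -(ENNReal.log (μ (⋂ k ∈ Finset.range n, T^[k] ⁻¹' Metric.ball 0 ε)) / (n : EReal))) atTop =
      ((Real.log q : ℝ) : EReal) := by
    obtain ⟨A, B, hA, hB, hAo, hBo, hAq, hBq, hbd, hAB⟩ := h ε ε.2
    let D (n : ℕ) := ⋂ k ∈ Finset.range n, T^[k] ⁻¹' Metric.ball (0 : E) ε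
    have hB0 (n : ℕ) : μ (B n) < ⊤ := (measure_mono (hB n.zero_le)).trans_lt hbd.measure_lt_top
    have hpos (n : ℕ) : 0 < μ (A n) := (hAo n).measure_pos μ ⟨0, (A n).zero_mem⟩
    have hAD (n : ℕ) : μ (A n) ≤ μ (D (n + 1)) := measure_mono (hAB n).1
    have hDB (n : ℕ) : μ (D (n + 1)) ≤ μ (B n) := measure_mono (hAB n).2
    have hDpos (n : ℕ) : 0 < μ (D (n + 1)) := (hpos n).trans_le (hAD n)
    have hDtop (n : ℕ) : μ (D (n + 1)) < ⊤ := (hDB n).trans_lt (hB0 n)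
    have hq0 : (q : ℝ) ≠ 0 := by exact_mod_cast hq
    have hlog (C : ℕ → AddSubgroup E) (hC : Antitone C) (hCo : ∀ n, IsOpen (C n : Set E))
        (hCq : ∀ n, (C (n + 1)).relIndex (C n) = q) (hCt : ∀ n, μ (C n) < ⊤) (n : ℕ) :
        Real.log (μ (C n)).toReal = Real.log (μ (C 0)).toReal - n * Real.log q := by
      have h1 : 0 < μ (C n) := (hCo n).measure_pos μ ⟨0, (C n).zero_mem⟩
      have h2 := congrArg ENNReal.toReal (measure_eq_pow_mul_of_relIndex μ hC
        (fun n => (hCo n).measurableSet) hq hCq n)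
      rw [ENNReal.toReal_mul, ENNReal.toReal_pow, ENNReal.toReal_natCast] at h2
      rw [h2, Real.log_mul (pow_ne_zero _ hq0) (ENNReal.toReal_pos h1.ne' (hCt n).ne).ne',
        Real.log_pow]
      ring
    have hlogA := hlog A hA hAo hAq fun n => ((hAD n).trans_lt (hDtop n))
    have hlogB := hlog B hB hBo hBq hB0
    have hlim (c : ℝ) : Tendsto (fun n : ℕ => (n * Real.log q - c) / (n + 1)) atTop
        (𝓝 (Real.log q)) := by
      have h1 := tendsto_one_div_add_atTop_nhds_zero_nat (𝕜 := ℝ)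
      have h2 := (h1.mul_const (Real.log q + c)).const_sub (Real.log q)
      rw [zero_mul, sub_zero] at h2
      refine h2.congr fun n => ?_
      have : (n : ℝ) + 1 ≠ 0 := by positivity
      field_simp
      ring
    have hreal : Tendsto (fun n : ℕ => -(Real.log (μ (D (n + 1))).toReal / (n + 1))) atTop
        (𝓝 (Real.log q)) := by
      refine tendsto_of_tendsto_of_tendsto_of_le_of_le (hlim (Real.log (μ (B 0)).toReal))
        (hlim (Real.log (μ (A 0)).toReal)) (fun n => ?_) (fun n => ?_)
      · have h1 := Real.log_le_log (ENNReal.toReal_pos (hDpos n).ne' (hDtop n).ne)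
          (ENNReal.toReal_mono (hB0 n).ne (hDB n))
        rw [hlogB] at h1
        simp only
        rw [← neg_div]
        gcongr
        linarith
      · have h1 := Real.log_le_log (ENNReal.toReal_pos (hpos n).ne' ((hAD n).trans_lt (hDtop n)).ne)
          (ENNReal.toReal_mono (hDtop n).ne (hAD n))
        rw [hlogA] at h1
        simp only
        rw [← neg_div]
        gcongr
        linarith
    have hE := (continuous_coe_real_ereal.tendsto _).comp hreal
    refine Tendsto.limsup_eq ((tendsto_add_atTop_iff_nat 1).1 (hE.congr fun n => ?_))
    change _ = -(ENNReal.log (μ (D (n + 1))) / ((n + 1 : ℕ) : EReal))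
    rw [ENNReal.log_pos_real (hDpos n).ne' (hDtop n).ne, ← EReal.coe_natCast, ← EReal.coe_div,
      ← EReal.coe_neg, Function.comp_apply]
    push_cast
    rfl
  have : Nonempty (Set.Ioi (0 : ℝ)) := ⟨⟨1, Set.mem_Ioi.2 one_pos⟩⟩
  rw [bowenEntropy, iSup_congr hε, ciSup_const]

end Entropy

/-! ### The entropy of an automorphism of a `p`-adic vector space -/

section PadicEntropy

variable {p : ℕ} [Fact p.Prime] {r : ℕ} {f : Fin r → ℚ_[p][X]}

open AdjoinRoot

local notation "ρ" => algebraMap ℤ_[p] ℚ_[p]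

/-- The first terms of the linear recurrent sequences associated with an element of
`∏ i, K[t] ⧸ (f i)`, as many as are needed to determine the element. -/
def firstTerms (hf : ∀ i, (f i).Monic) :
    (∀ i, AdjoinRoot (f i)) →ₗ[ℚ_[p]] ∀ i : Fin r, Fin (f i).natDegree → ℚ_[p] :=
  LinearMap.pi fun i => LinearMap.pi fun k =>
    topCoeff (hf i) ∘ₗ LinearMap.mulLeft ℚ_[p] (root (f i) ^ (k : ℕ)) ∘ₗ LinearMap.proj i

theorem firstTerms_apply (hf : ∀ i, (f i).Monic) (v : ∀ i, AdjoinRoot (f i)) (i : Fin r)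
    (k : Fin (f i).natDegree) :
    firstTerms hf v i k = topCoeff (hf i) (root (f i) ^ (k : ℕ) * v i) :=
  rfl

theorem firstTerms_injective (hf : ∀ i, (f i).Monic) : Function.Injective (firstTerms hf) := by
  rw [← LinearMap.ker_eq_bot, LinearMap.ker_eq_bot']
  intro v hv
  ext1 i
  exact eq_zero_of_topCoeff_eq_zero (hf i) fun k hk => congrFun (congrFun hv i) ⟨k, hk⟩

theorem mem_boundedTerms_zero_iff {hf : ∀ i, (f i).Monic} {c : ℚ_[p]} {v : ∀ i, AdjoinRoot (f i)} :
    v ∈ boundedTerms hf c 0 ↔ ‖firstTerms hf v‖ ≤ ‖c‖ := by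
  simp only [pi_norm_le_iff_of_nonneg (norm_nonneg c), mem_boundedTerms, zero_add, firstTerms_apply]
  exact forall_congr' fun i => ⟨fun h k => h k k.2, fun h k hk => h ⟨k, hk⟩⟩

/-- The entropy of an automorphism of a `ℚ_p`-vector space which is conjugate to multiplication by
`t` on `∏ i, K[t] ⧸ (f i)`, in terms of primitive multiples `g i` of the `f i`. -/
theorem padicEntropy_eq {V : Type} [AddCommGroup V] [Module ℚ_[p] V] {d : ℕ}
    (b : Module.Basis (Fin d) ℚ_[p] V) (T : V →ₗ[ℚ_[p]] V) (hf : ∀ i, (f i).Monic)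
    (e : V ≃ₗ[ℚ_[p]] ∀ i, AdjoinRoot (f i)) (he : ∀ v i, e (T v) i = root (f i) * e v i)
    {g : Fin r → ℤ_[p][X]} {u : Fin r → ℚ_[p]} (hg : ∀ i, (g i).IsPrimitive)
    (hu : ∀ i, u i ≠ 0) (hgf : ∀ i, (g i).map ρ = Polynomial.C (u i) * f i) :
    padicEntropy b T = ((Real.log (∏ i, p ^ (g i).leadingCoeff.valuation : ℕ) : ℝ) : EReal) := by
  let : MeasurableSpace (Fin d → ℚ_[p]) := borel _
  have : BorelSpace (Fin d → ℚ_[p]) := ⟨rfl⟩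
  let E : (Fin d → ℚ_[p]) ≃ₗ[ℚ_[p]] ∀ i, AdjoinRoot (f i) := b.equivFun.symm ≪≫ₗ e
  let T' (w : Fin d → ℚ_[p]) : Fin d → ℚ_[p] := b.equivFun (T (b.equivFun.symm w))
  have hT' (k : ℕ) (w : Fin d → ℚ_[p]) : E (T'^[k] w) = fun i => root (f i) ^ k * E w i := by
    induction k with
    | zero => simp
    | succ k ih =>
      ext1 i
      rw [Function.iterate_succ_apply', pow_succ', mul_assoc, ← congrFun ih i]
      simp only [E, T', LinearEquiv.trans_apply, LinearEquiv.symm_apply_apply, he]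
  let C (c : ℚ_[p]) (n : ℕ) : AddSubgroup (Fin d → ℚ_[p]) :=
    (boundedTerms hf c n).comap (E : (Fin d → ℚ_[p]) →+ _)
  have hC (c : ℚ_[p]) (n : ℕ) (w : Fin d → ℚ_[p]) :
      w ∈ C c n ↔ E w ∈ boundedTerms hf c n := Iff.rfl
  have hCanti (c : ℚ_[p]) : Antitone (C c) := fun m n hmn w hw => boundedTerms_anti hf c hmn hw
  have hCopen (c : ℚ_[p]) (hc : c ≠ 0) (n : ℕ) : IsOpen (C c n : Set (Fin d → ℚ_[p])) := by
    have : (C c n : Set (Fin d → ℚ_[p])) = ⋂ i, ⋂ k ∈ Finset.range (n + (f i).natDegree),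
        (fun w => topCoeff (hf i) (root (f i) ^ k * E w i)) ⁻¹' Metric.closedBall 0 ‖c‖ := by
      ext w
      simp [hC, mem_boundedTerms]
    rw [this]
    refine isOpen_iInter_of_finite fun i => isOpen_biInter_finset fun k _ => ?_
    refine (IsUltrametricDist.isOpen_closedBall 0 (norm_ne_zero_iff.2 hc)).preimage ?_
    exact (topCoeff (hf i) ∘ₗ LinearMap.mulLeft ℚ_[p] (root (f i) ^ k) ∘ₗ LinearMap.proj i ∘ₗ
      E.toLinearMap).continuous_of_finiteDimensional
  have hCq (c : ℚ_[p]) (hc : c ≠ 0) (n : ℕ) :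
      (C c (n + 1)).relIndex (C c n) = ∏ i, p ^ (g i).leadingCoeff.valuation := by
    rw [← relIndex_boundedTerms hf hg hu hgf hc n, AddSubgroup.relIndex_comap,
      AddSubgroup.map_comap_eq_self_of_surjective E.surjective]
  have hCT (c : ℚ_[p]) (n : ℕ) (w : Fin d → ℚ_[p]) :
      w ∈ C c n ↔ ∀ k ∈ Finset.range (n + 1), T'^[k] w ∈ C c 0 := by
    simp only [hC, hT', Finset.mem_range, Nat.lt_succ_iff]
    exact mem_boundedTerms_iff_forall_shift
  -- comparison of the maximum norm with the size of the first terms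
  let Θ : (Fin d → ℚ_[p]) →ₗ[ℚ_[p]] _ := firstTerms hf ∘ₗ E.toLinearMap
  have hC0 (c : ℚ_[p]) (w : Fin d → ℚ_[p]) : w ∈ C c 0 ↔ ‖Θ w‖ ≤ ‖c‖ := mem_boundedTerms_zero_iff
  obtain ⟨κ, -, hκ⟩ := (LinearMap.injective_iff_antilipschitz Θ).1
    ((firstTerms_injective hf).comp E.injective)
  have hκ' (w : Fin d → ℚ_[p]) : ‖w‖ ≤ κ * ‖Θ w‖ := by
    simpa using hκ.le_mul_dist w 0
  let Θ' : (Fin d → ℚ_[p]) →L[ℚ_[p]] _ := ⟨Θ, Θ.continuous_of_finiteDimensional⟩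
  refine bowenEntropy_eq_log _ (Finset.prod_ne_zero_iff.2 fun i _ =>
    pow_ne_zero _ (Fact.out : p.Prime).ne_zero) fun ε hε => ?_
  obtain ⟨c₁, hc₁, hc₁'⟩ := NormedField.exists_norm_lt ℚ_[p] (r := ε / (κ + 1)) (by positivity)
  obtain ⟨c₂, hc₂⟩ := NormedField.exists_lt_norm ℚ_[p] (‖Θ'‖ * ε)
  have hc₂0 : c₂ ≠ 0 := norm_pos_iff.1 (lt_of_le_of_lt (by positivity) hc₂)
  have hsub₁ (w : Fin d → ℚ_[p]) (hw : w ∈ C c₁ 0) : w ∈ Metric.ball 0 ε := by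
    rw [mem_ball_zero_iff]
    rw [hC0] at hw
    rw [lt_div_iff₀ (by positivity)] at hc₁'
    calc ‖w‖ ≤ κ * ‖Θ w‖ := hκ' w
      _ ≤ κ * ‖c₁‖ := by gcongr
      _ ≤ ‖c₁‖ * (κ + 1) := by
        have := norm_nonneg c₁
        linarith
      _ < ε := hc₁'
  have hsub₂ (w : Fin d → ℚ_[p]) (hw : w ∈ Metric.ball 0 ε) : w ∈ C c₂ 0 := by
    rw [mem_ball_zero_iff] at hw
    rw [hC0]
    calc ‖Θ' w‖ ≤ ‖Θ'‖ * ‖w‖ := Θ'.le_opNorm w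
      _ ≤ ‖Θ'‖ * ε := by gcongr
      _ ≤ ‖c₂‖ := hc₂.le
  refine ⟨C c₁, C c₂, hCanti _, hCanti _, hCopen _ (norm_pos_iff.1 hc₁), hCopen _ hc₂0,
    hCq _ (norm_pos_iff.1 hc₁), hCq _ hc₂0, ?_, fun n => ⟨fun w hw => ?_, fun w hw => ?_⟩⟩
  · refine (Metric.isBounded_closedBall (x := 0) (r := κ * ‖c₂‖)).subset fun w hw => ?_
    rw [mem_closedBall_zero_iff]
    exact (hκ' w).trans (mul_le_mul_of_nonneg_left ((hC0 _ _).1 hw) κ.2)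
  · exact Set.mem_iInter₂.2 fun k hk => hsub₁ _ ((hCT _ _ _).1 hw k hk)
  · exact (hCT _ _ _).2 fun k hk => hsub₂ _ (Set.mem_iInter₂.1 hw k hk)

end PadicEntropy

/-! ### The local entropies of the meridian and their sum -/

section LocalEntropy

theorem isPrimitive_prod {R ι : Type*} [CommRing R] [IsDomain R] [IsGCDMonoid R] (s : Finset ι)
    {g : ι → R[X]} (hg : ∀ i ∈ s, (g i).IsPrimitive) : (∏ i ∈ s, g i).IsPrimitive := by
  have : Nonempty (NormalizedGCDMonoid R) := inferInstance
  obtain ⟨_⟩ := this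
  exact Finset.prod_induction _ _ (fun _ _ h1 h2 => h1.mul h2) isPrimitive_one hg

variable {p : ℕ} [Fact p.Prime]

local notation "ρ" => algebraMap ℤ_[p] ℚ_[p]

/-- By Gauss's lemma, the product of primitive multiples of the factors of `Δ` over `ℚ_p` has the
same leading coefficient as `Δ`, up to a unit. -/
theorem log_prod_pow_valuation {Δ : ℤ[X]} (hΔ : IsUnit (Δ.eval 1)) {r : ℕ} {f : Fin r → ℚ_[p][X]}
    (hfΔ : Associated (∏ i, f i) (Δ.map (Int.castRingHom ℚ_[p])))
    {g : Fin r → ℤ_[p][X]} {u : Fin r → ℚ_[p]} (hg : ∀ i, (g i).IsPrimitive)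
    (hu : ∀ i, u i ≠ 0) (hgf : ∀ i, (g i).map ρ = Polynomial.C (u i) * f i) :
    Real.log (∏ i, p ^ (g i).leadingCoeff.valuation : ℕ) =
      -Real.log ‖(Δ.leadingCoeff : ℚ_[p])‖ := by
  have hD := isPrimitive_map_of_isUnit_eval_one hΔ (Int.castRingHom ℤ_[p])
  have hG := isPrimitive_prod Finset.univ fun i _ => hg i
  have hDm : (Δ.map (Int.castRingHom ℤ_[p])).map ρ = Δ.map (Int.castRingHom ℚ_[p]) := by
    rw [Polynomial.map_map]
    congr 1
  have hGm : Associated ((∏ i, g i).map ρ) (∏ i, f i) := by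
    rw [Polynomial.map_prod, Finset.prod_congr rfl fun i _ => hgf i, Finset.prod_mul_distrib]
    refine associated_unit_mul_left _ _ ?_
    rw [← map_prod]
    exact Polynomial.isUnit_C.2 (Finset.prod_ne_zero_iff.2 fun i _ => hu i).isUnit
  have hass := hGm.trans (hfΔ.trans (Associated.of_eq hDm.symm))
  have hass' : Associated (∏ i, g i) (Δ.map (Int.castRingHom ℤ_[p])) :=
    associated_of_dvd_dvd (hG.dvd_of_fraction_map_dvd_fraction_map hass.dvd)
      (hD.dvd_of_fraction_map_dvd_fraction_map hass.dvd')
  obtain ⟨w, hw⟩ := hass'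
  obtain ⟨c, hc, hcw⟩ := Polynomial.isUnit_iff.1 w.isUnit
  have hlead : ∏ i, ‖(g i).leadingCoeff‖ = ‖(Δ.leadingCoeff : ℚ_[p])‖ := by
    have h1 := congrArg (fun q => ‖q.leadingCoeff‖) hw
    simp only [leadingCoeff_mul, ← hcw, leadingCoeff_C, norm_mul,
      PadicInt.isUnit_iff.1 hc, mul_one, leadingCoeff_prod] at h1
    rw [leadingCoeff_map_of_injective (RingHom.injective_int _), norm_prod] at h1
    rw [h1, PadicInt.norm_def]
    rfl
  rw [← hlead, ← Real.log_inv, ← Finset.prod_inv_distrib]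
  congr 1
  rw [Nat.cast_prod]
  refine Finset.prod_congr rfl fun i _ => ?_
  rw [PadicInt.norm_eq_zpow_neg_valuation (leadingCoeff_ne_zero.2 (hg i).ne_zero), zpow_neg,
    inv_inv, Nat.cast_pow, zpow_natCast]

/-- The entropy of the action of `t` on the base change to `ℚ_p` of a module over `ℤ[t, t⁻¹]`. -/
theorem finiteDimensional_and_padicEntropy_of_isBaseChange
    {A : Type} [AddCommGroup A] [instA : Module ℤ A] [Module ℤ[T;T⁻¹] A] {n : ℕ} {x : Fin n → A}
    {Δ : ℤ[X]} (h1 : IsUnit (Δ.eval 1))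
    (hx : Submodule.span ℤ[T;T⁻¹] (Set.range x) = ⊤) (h0 : Δ.coeff 0 ≠ 0)
    (hΔ : IsGCDOfIdeal (initialFittingIdeal (R := ℤ[T;T⁻¹]) x) (toLaurent Δ))
    {V : Type} [AddCommGroup V] [Module ℚ_[p] V] (j : A →ₗ[ℤ] V) (hj : IsBaseChange ℚ_[p] j)
    (τ : V ≃ₗ[ℚ_[p]] V) (hτ : ∀ a, j ((T 1 : ℤ[T;T⁻¹]) • a) = τ (j a)) :
    FiniteDimensional ℚ_[p] V ∧ ∀ {d : ℕ} (b : Module.Basis (Fin d) ℚ_[p] V),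
      padicEntropy b (τ : V →ₗ[ℚ_[p]] V) =
        ((-Real.log ‖(Δ.leadingCoeff : ℚ_[p])‖ : ℝ) : EReal) := by
  obtain ⟨r, f, e, hf, hfΔ, he⟩ := exists_equiv_pi_adjoinRoot_of_isBaseChange hx h0 hΔ j hj τ hτ
  have hfin (i : Fin r) : Module.Finite ℚ_[p] (AdjoinRoot (f i)) :=
    (AdjoinRoot.powerBasis' (hf i)).finite
  refine ⟨Module.Finite.equiv e.symm, fun b => ?_⟩
  choose g hg u hu hgf using fun i => exists_isPrimitive_map_eq_C_mul (O := ℤ_[p]) (hf i).ne_zero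
  rw [padicEntropy_eq b _ hf e he hg hu hgf, log_prod_pow_valuation h1 hfΔ hg hu hgf]

end LocalEntropy

namespace InfiniteCyclicCover

variable {X : Type} [TopologicalSpace X]

theorem T_one_smul (C : InfiniteCyclicCover X) (a : C.AlexanderModule) :
    (T 1 : ℤ[T;T⁻¹]) • a = (C.meridian ℤ a : H1 ℤ C.E) := by
  have : laurentAction (C.meridian ℤ) (T 1) = (C.meridian ℤ).toLinearMap := by
    rw [laurentAction, T, AddMonoidAlgebra.lift_single, one_smul]
    simp
  exact LinearMap.congr_fun this a

/-- The value of the Alexander polynomial at `1` is `± 1`. -/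
theorem isUnit_eval_one_of_isAlexanderPolynomial (C : InfiniteCyclicCover X) {Δ : ℤ[X]}
    (hΔ : IsAlexanderPolynomial C Δ) : IsUnit (Δ.eval 1) := by
  obtain ⟨-, n, x, hx, hgcd⟩ := hΔ
  refine isUnit_eval_one hx hgcd.1 fun a => ?_
  obtain ⟨b, hb⟩ := C.meridian_sub_one_surjective a
  exact ⟨b, (congrArg (· - (b : C.AlexanderModule)) (C.T_one_smul b)).trans hb⟩

/-- The homology of the infinite cyclic cover over `ℚ_p` has finite dimension, and the entropy of
the meridian action on it is the local term at `p` of the leading coefficient of `Δ`. -/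
theorem finiteDimensional_and_padicEntropy (C : InfiniteCyclicCover X) {Δ : ℤ[X]}
    (hΔ : IsAlexanderPolynomial C Δ) (p : ℕ) [Fact p.Prime] :
    FiniteDimensional ℚ_[p] (H1 ℚ_[p] C.E) ∧
      ∀ {d : ℕ} (b : Module.Basis (Fin d) ℚ_[p] (H1 ℚ_[p] C.E)),
        padicEntropy b (C.meridian ℚ_[p] : H1 ℚ_[p] C.E →ₗ[ℚ_[p]] H1 ℚ_[p] C.E) =
          ((-Real.log ‖(Δ.leadingCoeff : ℚ_[p])‖ : ℝ) : EReal) := by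
  have h1 := C.isUnit_eval_one_of_isAlexanderPolynomial hΔ
  obtain ⟨h0, n, x, hx, hgcd⟩ := hΔ
  obtain ⟨j, hj, hjt⟩ := exists_isBaseChange_H1 ℚ_[p] C.t
  let instA : Module ℤ C.AlexanderModule := inferInstanceAs (Module ℤ (H1 ℤ C.E))
  let j' : C.AlexanderModule →ₗ[ℤ] H1 ℚ_[p] C.E := j
  have hj' : IsBaseChange ℚ_[p] j' := hj
  have hjt' (a : C.AlexanderModule) : j' ((T 1 : ℤ[T;T⁻¹]) • a) = C.meridian ℚ_[p] (j' a) :=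
    (congrArg j (C.T_one_smul a)).trans (hjt a)
  exact finiteDimensional_and_padicEntropy_of_isBaseChange h1 hx h0 hgcd j' hj'
    (C.meridian ℚ_[p]) hjt'

end InfiniteCyclicCover

end

theorem corollary5 (K : Set ThreeSphere) (hK : IsKnot K)
    (C : InfiniteCyclicCover {x : ThreeSphere // x ∉ K})
    (Δ : ℤ[X]) (hΔ : IsAlexanderPolynomial C Δ)
    (ι : ∀ p : Nat.Primes, AlgebraicClosure ℚ →+* PadicAlgCl (p : ℕ)) :
    (∀ p : Nat.Primes, FiniteDimensional ℚ_[(p : ℕ)] (H1 ℚ_[(p : ℕ)] C.E)) ∧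
    (∀ b : ∀ p : Nat.Primes, Module.Basis (Fin (Module.finrank ℚ_[(p : ℕ)] (H1 ℚ_[(p : ℕ)] C.E)))
        ℚ_[(p : ℕ)] (H1 ℚ_[(p : ℕ)] C.E),
      HasSum (fun p : Nat.Primes =>
          padicEntropy (b p) (C.meridian ℚ_[(p : ℕ)] : H1 ℚ_[(p : ℕ)] C.E →ₗ[ℚ_[(p : ℕ)]] _))
        ((Real.log |(Δ.leadingCoeff : ℝ)| : ℝ) : EReal)) ∧
    HasSum (fun p : Nat.Primes => localZeroSum Δ (p : ℕ) (ι p))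
      (Real.log |(Δ.leadingCoeff : ℝ)|) := by
  have hne : Δ.leadingCoeff ≠ 0 := by
    rw [leadingCoeff_ne_zero]
    rintro rfl
    exact hΔ.1 rfl
  have hsum := hasSum_neg_log_norm hne
  refine ⟨fun p => (C.finiteDimensional_and_padicEntropy hΔ p).1, fun b => ?_, ?_⟩
  · simp_rw [fun p : Nat.Primes => (C.finiteDimensional_and_padicEntropy hΔ p).2 (b p)]
    exact hsum.map (⟨⟨((↑) : ℝ → EReal), EReal.coe_zero⟩, EReal.coe_add⟩ : ℝ →+ EReal)
      continuous_coe_real_ereal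
  · simp_rw [fun p : Nat.Primes => localZeroSum_eq
      (C.isUnit_eval_one_of_isAlexanderPolynomial hΔ) (ι p)]
    exact hsum
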